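/- Let $G=(V,E,w)$ be a finite undirected graph (self-loops allowed) with $n=|V|$ vertices and positive edge weights $w:E\to(0,\infty)$. For a vertex $v$ put $w(v)=\sum_{u\sim v}w(u,v)$, and assume $w(v)>0$ for every $v\in V$. For a non-empty $S\subseteq V$ put $w(S)=\sum_{v\in S}w(v)$ and define its expansion by $$\phi_G(S)=\frac{w(E(S,\overline S))}{w(S)},$$ where $w(E(S,\overline S))$ is the total weight of the edges with one endpoint in $S$ and the other outside $S$. Let $\ell^2(V,w)$ be the space of functions $V\to\mathbb R$ with inner product $\langle f,g\rangle=\sum_{v\in V}w(v)f(v)g(v)$. Let $\lambda_1\le\lambda_2\le\dots\le\lambda_n$ be the eigenvalues, with multiplicity, of the normalized Laplacian $I-D^{-1/2}AD^{-1/2}$, where $A$ is the weighted adjacency matrix and $D$ the diagonal matrix with entries $w(v)$. All sums over $u\sim v$ with both endpoints varying are over unordered edges, and $\log$ is the natural logarithm. There is a universal constant $C>0$ such that for every such $G$, every $k\in\{1,\dots,n\}$ and every $\delta\in(0,1)$ the following two statements hold. (1) If $f_1,\dots,f_k:V\to\mathbb R$ is an orthonormal system in $\ell^2(V,w)$, then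 there exist $r\ge\lceil(1-\delta)k\rceil$ non-empty, pairwise disjoint sets $S_1,\dots,S_r\subseteq V$ such that for every $j$ $$\phi_G(S_j)\le\frac{C}{\delta^3}\sqrt{R\,\log k},\qquad R=\frac{\sum_{i=1}^k\sum_{u\sim v}w(u,v)\,(f_i(u)-f_i(v))^2}{\sum_{i=1}^k\sum_{v\in V}w(v)\,f_i(v)^2}.$$ (2) There exist $r\ge\lceil(1-\delta)k\rceil$ non-empty, pairwise disjoint sets $S_1,\dots,S_r\subseteq V$ such that for every $j$ $$\phi_G(S_j)\le\frac{C}{\delta^3}\sqrt{\lambda_k\,\log k}.$$ -/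

import Mathlib

/-- A finite undirected weighted graph on the vertex set `V`: a finite set of edges (unordered
pairs of vertices, self-loops being allowed) with positive weights on the edges.  The values of
`weight` off the edge set are never used. -/
structure WeightedGraph (V : Type*) where
  edges : Finset (Sym2 V)
  weight : Sym2 V → ℝ
  weight_pos : ∀ e ∈ edges, 0 < weight e

namespace WeightedGraph

/-- The weighted adjacency matrix: `w(u,v)` if `u ∼ v`, and `0` otherwise. -/
def adjacency {V : Type*} [DecidableEq V] (G : WeightedGraph V) : Matrix V V ℝ :=
  Matrix.of fun u v => if s(u, v) ∈ G.edges then G.weight s(u, v) else 0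

/-- The weight (weighted degree) of a vertex, `w(v) = ∑_{u ∼ v} w(u,v)`. -/
def vertexWeight {V : Type*} [Fintype V] [DecidableEq V] (G : WeightedGraph V) (v : V) : ℝ :=
  ∑ u with s(u, v) ∈ G.edges, G.weight s(u, v)

/-- The weight of a set of vertices, `w(S) = ∑_{v ∈ S} w(v)`. -/
def setWeight {V : Type*} [Fintype V] [DecidableEq V] (G : WeightedGraph V) (S : Finset V) : ℝ :=
  ∑ v ∈ S, G.vertexWeight v

/-- The edges with one endpoint in `S` and the other one outside of `S`. -/
def cut {V : Type*} [Fintype V] [DecidableEq V] (G : WeightedGraph V) (S : Finset V) :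
    Finset (Sym2 V) :=
  {e ∈ G.edges | ∃ u v, u ∈ S ∧ v ∉ S ∧ e = s(u, v)}

/-- The expansion (Dirichlet conductance) of `S`, `φ_G(S) = w(E(S, Sᶜ)) / w(S)`. -/
noncomputable def expansion {V : Type*} [Fintype V] [DecidableEq V] (G : WeightedGraph V)
    (S : Finset V) : ℝ :=
  (∑ e ∈ G.cut S, G.weight e) / G.setWeight S

/-- The Dirichlet energy `∑_{u ∼ v} w(u,v) (f(u) - f(v))²`, each edge being counted once. -/
def energy {V : Type*} (G : WeightedGraph V) (f : V → ℝ) : ℝ :=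
  ∑ e ∈ G.edges, G.weight e *
    Sym2.lift ⟨fun u v => (f u - f v) ^ 2, fun u v => by ring⟩ e

/-- The inner product of `ℓ²(V, w)`. -/
def innerW {V : Type*} [Fintype V] [DecidableEq V] (G : WeightedGraph V) (f g : V → ℝ) : ℝ :=
  ∑ v, G.vertexWeight v * f v * g v

/-- The functions `f i` form an orthonormal system in `ℓ²(V, w)`. -/
def IsOrthonormalSystem {V : Type*} [Fintype V] [DecidableEq V] (G : WeightedGraph V) {k : ℕ}
    (f : Fin k → V → ℝ) : Prop :=
  ∀ i j, G.innerW (f i) (f j) = if i = j then 1 else 0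

/-- The aggregate Rayleigh quotient of `f₁, …, f_k`, that is, the Rayleigh quotient of the map
`v ↦ (f₁(v), …, f_k(v))`. -/
noncomputable def aggregateRayleigh {V : Type*} [Fintype V] [DecidableEq V] (G : WeightedGraph V)
    {k : ℕ} (f : Fin k → V → ℝ) : ℝ :=
  (∑ i, G.energy (f i)) / ∑ i, ∑ v, G.vertexWeight v * f i v ^ 2

/-- The matrix `D^{-1/2}`, where `D` is the diagonal matrix of the vertex weights. -/
noncomputable def invSqrtDegree {V : Type*} [Fintype V] [DecidableEq V] (G : WeightedGraph V) :
    Matrix V V ℝ :=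
  Matrix.diagonal fun v => (Real.sqrt (G.vertexWeight v))⁻¹

/-- The normalized Laplacian `I - D^{-1/2} A D^{-1/2}`. -/
noncomputable def normalizedLaplacian {V : Type*} [Fintype V] [DecidableEq V]
    (G : WeightedGraph V) : Matrix V V ℝ :=
  1 - G.invSqrtDegree * G.adjacency * G.invSqrtDegree

theorem normalizedLaplacian_isHermitian {V : Type*} [Fintype V] [DecidableEq V]
    (G : WeightedGraph V) : G.normalizedLaplacian.IsHermitian := by
  ext u v
  simp [normalizedLaplacian, invSqrtDegree, adjacency, Matrix.one_apply, Sym2.eq_swap (a := u),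
    eq_comm (a := u)]
  split_ifs <;> ring

/-- The `k`-th smallest eigenvalue `λ_k` of the normalized Laplacian, counted with multiplicity,
for `1 ≤ k ≤ n = |V|`.  (Mathlib lists the `n` eigenvalues in decreasing order, starting at
index `0`, so that `λ_k` has index `n - k`.) -/
noncomputable def eigenvalue {V : Type*} [Fintype V] [DecidableEq V] (G : WeightedGraph V)
    (k : ℕ) (h₁ : 1 ≤ k) (h₂ : k ≤ Fintype.card V) : ℝ :=
  G.normalizedLaplacian_isHermitian.eigenvalues₀ ⟨Fintype.card V - k, by omega⟩

end WeightedGraph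

/-! Send v to F(v) = (f₁(v), …, f_k(v)) in ℝ^k and give v the mass w(v)‖F(v)‖², of total k.
Orthonormality makes F isotropic, so the vertices whose direction F/‖F‖ lies near a given unit
vector carry mass hardly more than 1 (`sum_near_le_of_isotropic`). A partition by direction that
rarely joins far directions therefore has little mass in heavy classes, and the light classes can be
regrouped into almost k groups of mass at least 1/8 (`exists_label_groups`).

The partition is random (`exists_random_clustering`). Splitting coordinates into positive and
negative parts turns a direction into a nonnegative unit vector, whose squared entries form a
probability density. The m-fold product densities are sampled jointly by correlated sampling, the
sample being the label. Hellinger affinity is multiplicative over products, so directions at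
distance d are separated with probability at most 2√m·d and joined with probability at most
exp(-md²/4) + ε.

With m of order log k / δ, joined far pairs are negligible, while Cauchy–Schwarz bounds the expected
ℓ¹ energy of ‖F‖² restricted to the groups by O(k√(mR)). Markov's inequality fixes one outcome good
for both. Discarding the few expensive groups and taking a superlevel set of ‖F‖² inside each
remaining one (`exists_expansion_le`) gives the disjoint sets.

The second statement applies the first to the eigenvectors of λ₁, …, λ_k rescaled by D^{-1/2}, whose
energies are these eigenvalues, so that R ≤ λ_k. -/

/-! ### Layer cake and correlated sampling -/

/-- A finite set of nonnegative reals carries weights realising the layer-cake formula. -/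
theorem exists_layer_weights (s : Finset ℝ) (hs : ∀ t ∈ s, 0 ≤ t) :
    ∃ q : ℝ → ℝ, (∀ t, 0 ≤ q t) ∧ ∀ x ∈ s, ∑ t ∈ s with t ≤ x, q t = x := by
  induction s using Finset.induction_on_max with
  | empty => exact ⟨0, by simp, by simp⟩
  | insert m s hm ih =>
    obtain ⟨q, hq, hx⟩ := ih fun t ht => hs t (Finset.mem_insert_of_mem ht)
    have hle : ∑ t ∈ s, q t ≤ m := by
      rcases s.eq_empty_or_nonempty with rfl | hne
      · simpa using hs m (by simp)
      · have h := hx _ (s.max'_mem hne)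
        rw [Finset.filter_true_of_mem fun t ht => s.le_max' t ht] at h
        exact h ▸ (hm _ (s.max'_mem hne)).le
    have hms : m ∉ s := fun h => (hm m h).false
    -- The weight of a level is its gap to the preceding level, or to 0 for the lowest one.
    refine ⟨Function.update q m (m - ∑ t ∈ s, q t), fun t => ?_, fun x hx' => ?_⟩
    · by_cases h : t = m
      · subst h; simpa using hle
      · simpa [h] using hq t
    · have hcongr : ∀ r ⊆ s, ∑ t ∈ r, Function.update q m (m - ∑ t ∈ s, q t) t = ∑ t ∈ r, q t :=
        fun r hr => Finset.sum_congr rfl fun t ht =>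
          Function.update_of_ne (fun h => hms (by rw [← h]; exact hr ht)) _ _
      rcases Finset.mem_insert.1 hx' with rfl | hxs
      · rw [Finset.filter_true_of_mem, Finset.sum_insert hms, hcongr s subset_rfl]
        · simp
        · intro t ht
          rcases Finset.mem_insert.1 ht with rfl | h
          · exact le_rfl
          · exact (hm t h).le
      · rw [Finset.filter_insert, if_neg (not_le.2 (hm x hxs)),
          hcongr _ (Finset.filter_subset _ _), hx x hxs]

/-- One round of correlated sampling: densities on a finite set are realised, up to a common
factor, as the probabilities of events in one finite probability space. -/
theorem exists_coupled_events {V Ω : Type*} [Fintype V] [Fintype Ω] (v₀ : V) (p : V → Ω → ℝ)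
    (hp : ∀ v ω, 0 ≤ p v ω) (hp1 : ∀ v, ∑ ω, p v ω = 1) :
    ∃ (N : ℕ) (π : Fin N → ℝ) (B : V → Fin N → Prop) (c : ℝ), 0 < c ∧ c ≤ 1 ∧ (∀ x, 0 ≤ π x) ∧
      ∑ x, π x = 1 ∧
      ∀ u v, (open Classical in ∑ x, π x * (if B u x ∧ B v x then 1 else 0)) =
        c * ∑ ω, min (p u ω) (p v ω) := by
  classical
  set s : Finset ℝ := Finset.univ.image fun x : V × Ω => p x.1 x.2 with hsdef
  have hmem : ∀ v ω, p v ω ∈ s := fun v ω =>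
    Finset.mem_image.2 ⟨(v, ω), Finset.mem_univ _, rfl⟩
  obtain ⟨q, hq, hqs⟩ := exists_layer_weights s (by
    intro t ht
    obtain ⟨x, -, rfl⟩ := Finset.mem_image.1 ht
    exact hp _ _)
  -- A dart (ω, t) is thrown with probability q(t)/Z, and v accepts it when it falls under the graph
  -- of p v. Two vertices both accept under the minimum of their graphs.
  set Z : ℝ := ∑ x : Ω × s, q x.2 with hZ
  have key : ∀ u v, ∑ x : Ω × s, q x.2 * (if (x.2 : ℝ) ≤ p u x.1 ∧ (x.2 : ℝ) ≤ p v x.1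
      then 1 else 0) = ∑ ω, min (p u ω) (p v ω) := by
    intro u v
    rw [Fintype.sum_prod_type]
    refine Finset.sum_congr rfl fun ω _ => ?_
    have hm : min (p u ω) (p v ω) ∈ s := by
      rcases min_choice (p u ω) (p v ω) with h | h <;> rw [h] <;> exact hmem _ _
    rw [← hqs _ hm, Finset.sum_filter]
    rw [← Finset.sum_coe_sort s]
    exact Finset.sum_congr rfl fun t _ => by simp
  have hZ1 : 1 ≤ Z := by
    have h := key v₀ v₀
    simp only [min_self, hp1] at h
    rw [← h]
    refine Finset.sum_le_sum fun x _ => ?_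
    split_ifs
    · simp
    · simpa using hq _
  have hZ0 : 0 < Z := by linarith
  let e := Fintype.equivFin (Ω × s)
  refine ⟨Fintype.card (Ω × s), fun i => q (e.symm i).2 / Z,
    fun v i => ((e.symm i).2 : ℝ) ≤ p v (e.symm i).1, 1 / Z, by positivity,
    by rw [div_le_one hZ0]; exact hZ1, fun x => div_nonneg (hq _) hZ0.le, ?_, fun u v => ?_⟩
  · rw [e.symm.sum_comp fun x => q x.2 / Z, ← Finset.sum_div, ← hZ, div_self hZ0.ne']
  · rw [← key u v, Finset.mul_sum, ← e.symm.sum_comp]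
    refine Finset.sum_congr rfl fun i _ => ?_
    split_ifs <;> ring

/-- Correlated sampling: densities on a finite set can be sampled jointly so that two samples
coincide about as often as the two densities permit. -/
theorem exists_correlated_labels {V Ω : Type*} [Fintype V] [Fintype Ω] (v₀ : V) (p : V → Ω → ℝ)
    (hp : ∀ v ω, 0 ≤ p v ω) (hp1 : ∀ v, ∑ ω, p v ω = 1) {ε : ℝ} (hε : 0 < ε) :
    ∃ (Θ : Type) (_ : Fintype Θ) (q : Θ → ℝ) (l : Θ → V → ℕ), (∀ θ, 0 ≤ q θ) ∧ ∑ θ, q θ = 1 ∧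
      (∀ u v, ∑ θ, q θ * (if l θ u = l θ v then 0 else 1) ≤ ∑ ω, |p u ω - p v ω|) ∧
      ∀ u v, ∑ θ, q θ * (if l θ u = l θ v then 1 else 0) ≤ ∑ ω, min (p u ω) (p v ω) + ε := by
  classical
  obtain ⟨K, π, B, c, hc0, hc1, hπ, hπ1, hB⟩ := exists_coupled_events v₀ p hp hp1
  have hB1 : ∀ v, ∑ x, π x * (if B v x then 1 else 0) = c := fun v => by
    simpa [hp1] using hB v v
  have habs : ∀ u v, ∑ ω, |p u ω - p v ω| = 2 - 2 * ∑ ω, min (p u ω) (p v ω) := fun u v => by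
    have : ∀ ω, |p u ω - p v ω| = p u ω + p v ω - 2 * min (p u ω) (p v ω) := fun ω => by
      rcases le_total (p u ω) (p v ω) with h | h
      · rw [min_eq_left h, abs_of_nonpos (by linarith)]; ring
      · rw [min_eq_right h, abs_of_nonneg (by linarith)]; ring
    simp only [this, Finset.sum_sub_distrib, Finset.sum_add_distrib, hp1, ← Finset.mul_sum]
    ring
  have hmin1 : ∀ u v, ∑ ω, min (p u ω) (p v ω) ≤ 1 := fun u v =>
    (Finset.sum_le_sum fun ω _ => min_le_left _ _).trans (hp1 u).le
  have hmin0 : ∀ u v, 0 ≤ ∑ ω, min (p u ω) (p v ω) := fun u v =>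
    Finset.sum_nonneg fun ω _ => le_min (hp _ _) (hp _ _)
  -- After N independent darts, the label of v records the round of the dart it takes, with default
  -- 0 if it accepts none. Two vertices that accept nothing share the label 0, which is why the
  -- error (1 - c)^N appears.
  have main : ∀ N : ℕ, ∃ (Θ : Type) (_ : Fintype Θ) (q : Θ → ℝ) (l : Θ → V → ℕ),
      (∀ θ, 0 ≤ q θ) ∧ ∑ θ, q θ = 1 ∧ (∀ θ v, l θ v ≤ N) ∧
      (∀ u v, ∑ θ, q θ * (if l θ u = l θ v then 0 else 1) ≤ ∑ ω, |p u ω - p v ω|) ∧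
      ∀ u v, ∑ θ, q θ * (if l θ u = l θ v then 1 else 0) ≤
        ∑ ω, min (p u ω) (p v ω) + (1 - c) ^ N := by
    intro N
    induction N with
    | zero =>
      refine ⟨Unit, inferInstance, fun _ => 1, fun _ _ => 0, by simp, by simp, by simp, ?_, ?_⟩
      · intro u v
        simpa using Finset.sum_nonneg fun ω _ => abs_nonneg (p u ω - p v ω)
      · intro u v
        simpa using hmin0 u v
    | succ N ih =>
      obtain ⟨Θ, _, q, l, hq, hq1, hl, hsep, hsame⟩ := ih
      have hrec : ∀ u v, ∑ y : Fin K × Θ, π y.1 * q y.2 *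
          (if (if B u y.1 then N + 1 else l y.2 u) = (if B v y.1 then N + 1 else l y.2 v)
            then (1 : ℝ) else 0) =
          c * ∑ ω, min (p u ω) (p v ω) + (1 - (2 * c - c * ∑ ω, min (p u ω) (p v ω))) *
            ∑ θ, q θ * (if l θ u = l θ v then 1 else 0) := by
        intro u v
        have hx : ∀ x, ∑ θ, π x * q θ *
            (if (if B u x then N + 1 else l θ u) = (if B v x then N + 1 else l θ v)
              then (1 : ℝ) else 0) = π x * (if B u x ∧ B v x then 1 else 0) +
              (π x - (π x * (if B u x then 1 else 0) + π x * (if B v x then 1 else 0) -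
                π x * (if B u x ∧ B v x then 1 else 0))) *
              ∑ θ, q θ * (if l θ u = l θ v then 1 else 0) := by
          intro x
          have h1 : ∀ θ v, N + 1 ≠ l θ v := fun θ v => by have := hl θ v; omega
          have h2 : ∀ θ v, l θ v ≠ N + 1 := fun θ v => by have := hl θ v; omega
          simp only [mul_assoc (π x), ← Finset.mul_sum]
          by_cases hu : B u x <;> by_cases hv : B v x <;> simp [hu, hv, h1, h2, hq1]
        rw [Fintype.sum_prod_type]
        simp only [hx]
        rw [Finset.sum_add_distrib, ← Finset.sum_mul, Finset.sum_sub_distrib,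
          Finset.sum_sub_distrib, Finset.sum_add_distrib, hB, hB1, hB1, hπ1]
        ring
      have hone : ∑ y : Fin K × Θ, π y.1 * q y.2 = 1 := by
        rw [Fintype.sum_prod_type]
        simp [← Finset.mul_sum, hq1, hπ1]
      have hcompl : ∀ {Θ : Type} [Fintype Θ] (q : Θ → ℝ) (l : Θ → V → ℕ) (u v : V),
          ∑ θ, q θ = 1 → ∑ θ, q θ * (if l θ u = l θ v then (0 : ℝ) else 1) =
            1 - ∑ θ, q θ * (if l θ u = l θ v then 1 else 0) := by
        intro Θ _ q l u v h
        rw [eq_sub_iff_add_eq, ← Finset.sum_add_distrib]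
        refine Eq.trans ?_ h
        refine Finset.sum_congr rfl fun θ _ => ?_
        split_ifs <;> simp
      refine ⟨Fin K × Θ, inferInstance, fun y => π y.1 * q y.2,
        fun y v => if B v y.1 then N + 1 else l y.2 v,
        fun y => mul_nonneg (hπ _) (hq _), hone, ?_, ?_, ?_⟩
      · intro y v
        have := hl y.2 v
        dsimp only
        split_ifs <;> omega
      · intro u v
        rw [hcompl (fun y : Fin K × Θ => π y.1 * q y.2)
          (fun y v => if B v y.1 then N + 1 else l y.2 v) u v hone, hrec]
        have h := hsep u v
        rw [hcompl q l u v hq1] at h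
        rw [habs] at h ⊢
        have hm := hmin1 u v
        have hm0 := hmin0 u v
        set m := ∑ ω, min (p u ω) (p v ω)
        set T := ∑ θ, q θ * (if l θ u = l θ v then (1 : ℝ) else 0)
        have hT : T ≤ 1 := by
          rw [← hq1]
          refine Finset.sum_le_sum fun θ _ => ?_
          split_ifs
          · simp
          · simpa using hq θ
        -- The new coincidence probability is T' = cm + (1 - 2c + cm)T, and T' - (2m - 1) is exactly
        -- the sum of the two products `e1` and `e2`.
        have e1 : 0 ≤ (1 - c) * (T - (2 * m - 1)) :=
          mul_nonneg (by linarith) (by linarith)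
        have e2 : 0 ≤ c * ((1 - m) * (1 - T)) :=
          mul_nonneg hc0.le (mul_nonneg (by linarith) (by linarith))
        nlinarith
      · intro u v
        rw [hrec]
        have h := hsame u v
        have hm := hmin1 u v
        have hm0 := hmin0 u v
        set m := ∑ ω, min (p u ω) (p v ω)
        set T := ∑ θ, q θ * (if l θ u = l θ v then (1 : ℝ) else 0)
        have hT : 0 ≤ T := Finset.sum_nonneg fun θ _ => by
          split_ifs
          · simpa using hq θ
          · simp
        have e1 : 0 ≤ (1 - c) * (m + (1 - c) ^ N - T) :=
          mul_nonneg (by linarith) (by linarith)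
        have e2 : 0 ≤ c * ((1 - m) * T) :=
          mul_nonneg hc0.le (mul_nonneg (by linarith) hT)
        rw [pow_succ]
        nlinarith
  obtain ⟨N, hN⟩ := exists_pow_lt_of_lt_one hε (show 1 - c < 1 by linarith)
  obtain ⟨Θ, i, q, l, h1, h2, -, h3, h4⟩ := main N
  exact ⟨Θ, i, q, l, h1, h2, h3, fun u v => (h4 u v).trans (by linarith)⟩

/-! ### Markov's inequality and grouping of weights -/

/-- Markov's inequality for two quantities at once, on a finite probability space. -/
theorem exists_le_three_mul_expectation {Θ : Type*} [Fintype Θ] (q X Y : Θ → ℝ)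
    (hq : ∀ θ, 0 ≤ q θ) (hq1 : ∑ θ, q θ = 1) (hX : ∀ θ, 0 ≤ X θ) (hY : ∀ θ, 0 ≤ Y θ)
    {a b : ℝ} (ha : ∑ θ, q θ * X θ ≤ a) (hb : ∑ θ, q θ * Y θ ≤ b) :
    ∃ θ, X θ ≤ 3 * a ∧ Y θ ≤ 3 * b := by
  have markov : ∀ (X : Θ → ℝ) (a : ℝ), (∀ θ, 0 ≤ X θ) → ∑ θ, q θ * X θ ≤ a →
      ∑ θ, q θ * (if X θ ≤ 3 * a then 0 else 1) ≤ 1 / 3 := by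
    intro X a hX ha
    have hnn : ∀ θ ∈ Finset.univ, 0 ≤ q θ * X θ := fun θ _ => mul_nonneg (hq θ) (hX θ)
    -- For a = 0 one cannot divide by a; then X vanishes wherever q does not.
    rcases (Finset.sum_nonneg hnn |>.trans ha).eq_or_lt with h0 | h0
    · subst h0
      have h := (Finset.sum_eq_zero_iff_of_nonneg hnn).1 (le_antisymm ha (Finset.sum_nonneg hnn))
      rw [Finset.sum_eq_zero]
      · norm_num
      · intro θ hθ
        rcases mul_eq_zero.1 (h θ hθ) with h | h <;> simp [h]
    · have : (3 * a) * ∑ θ, q θ * (if X θ ≤ 3 * a then 0 else 1) ≤ a := by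
        refine le_trans ?_ ha
        rw [Finset.mul_sum]
        refine Finset.sum_le_sum fun θ _ => ?_
        split_ifs with h
        · simpa using mul_nonneg (hq θ) (hX θ)
        · nlinarith [hq θ, not_le.1 h]
      nlinarith
  by_contra! hcon
  have h1 := markov X a hX ha
  have h2 := markov Y b hY hb
  have h3 : ∑ θ, q θ ≤ ∑ θ, q θ * (if X θ ≤ 3 * a then 0 else 1) +
      ∑ θ, q θ * (if Y θ ≤ 3 * b then 0 else 1) := by
    rw [← Finset.sum_add_distrib]
    refine Finset.sum_le_sum fun θ _ => ?_
    by_cases hx : X θ ≤ 3 * a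
    · simp [hx, not_le.2 (hcon θ hx)]
    · simp only [hx, if_false]
      have : 0 ≤ q θ * (if Y θ ≤ 3 * b then 0 else 1) := by
        split_ifs <;> simp [hq θ]
      linarith
  linarith

/-- Items of weight at most `c` can be grouped into disjoint groups of weight at least `β`, the
number of which is essentially the total weight divided by `c`. -/
theorem exists_grouping {ι : Type*} [DecidableEq ι] (M : ι → ℝ) (hM : ∀ i, 0 ≤ M i) {c β : ℝ}
    (hβ : 0 < β) (hβc : 2 * β ≤ c) (J : Finset ι) (hJ : ∀ i ∈ J, M i ≤ c) :
    ∃ P : Finset (Finset ι), (∀ T ∈ P, T ⊆ J) ∧ (∀ T ∈ P, β ≤ ∑ i ∈ T, M i) ∧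
      (∀ T ∈ P, ∀ T' ∈ P, T ≠ T' → Disjoint T T') ∧ ∑ i ∈ J, M i ≤ c * P.card + β := by
  induction J using Finset.strongInduction with
  | H J ih =>
  by_cases hsmall : ∑ i ∈ J, M i < β
  · exact ⟨∅, by simp, by simp, by simp, by simpa using hsmall.le⟩
  obtain ⟨T, hTmem, hTmin⟩ := Finset.exists_min_image
    (J.powerset.filter fun T => β ≤ ∑ i ∈ T, M i) Finset.card
    ⟨J, by simpa using not_lt.1 hsmall⟩
  simp only [Finset.mem_filter, Finset.mem_powerset] at hTmem hTmin
  obtain ⟨hTJ, hTβ⟩ := hTmem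
  have hmin : ∀ a ∈ T, ∑ i ∈ T.erase a, M i < β := by
    intro a ha
    by_contra! h
    have := hTmin (T.erase a) ⟨(T.erase_subset a).trans hTJ, h⟩
    have := Finset.card_erase_lt_of_mem ha
    omega
  have hne : T.Nonempty := by
    rw [Finset.nonempty_iff_ne_empty]
    rintro rfl
    simp at hTβ
    linarith
  obtain ⟨a, ha⟩ := hne
  -- A group of least cardinality among those of weight at least β is either a single item or falls
  -- below β on removing any item. In the second case the removed item is itself lighter than β, so
  -- the weight is below 2β.
  have hTc : ∑ i ∈ T, M i ≤ c := by
    have hsplit := Finset.add_sum_erase T M ha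
    by_cases hb : ∃ b ∈ T, b ≠ a
    · obtain ⟨b, hb, hba⟩ := hb
      have h1 : M a ≤ ∑ i ∈ T.erase b, M i :=
        Finset.single_le_sum (fun i _ => hM i) (Finset.mem_erase.2 ⟨hba.symm, ha⟩)
      linarith [hmin a ha, hmin b hb]
    · push Not at hb
      have : T = {a} := Finset.eq_singleton_iff_unique_mem.2 ⟨ha, hb⟩
      rw [this, Finset.sum_singleton]
      exact hJ a (hTJ ha)
  have hss : J \ T ⊂ J :=
    Finset.sdiff_ssubset hTJ ⟨a, ha⟩
  obtain ⟨P, hP1, hP2, hP3, hP4⟩ := ih (J \ T) hss fun i hi => hJ i (Finset.mem_sdiff.1 hi).1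
  have hdisj : ∀ T' ∈ P, Disjoint T T' := fun T' hT' =>
    Finset.disjoint_sdiff.mono_right (hP1 T' hT')
  have hTP : T ∉ P := fun h => (Finset.disjoint_left.1 (hdisj T h) ha) ha
  refine ⟨insert T P, ?_, ?_, ?_, ?_⟩
  · intro T' hT'
    rcases Finset.mem_insert.1 hT' with rfl | h
    · exact hTJ
    · exact (hP1 T' h).trans Finset.sdiff_subset
  · intro T' hT'
    rcases Finset.mem_insert.1 hT' with rfl | h
    · exact hTβ
    · exact hP2 T' h
  · intro T₁ h₁ T₂ h₂ hne
    rcases Finset.mem_insert.1 h₁ with e₁ | m₁ <;> rcases Finset.mem_insert.1 h₂ with e₂ | m₂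
    · exact absurd (e₁.trans e₂.symm) hne
    · exact e₁ ▸ hdisj _ m₂
    · exact e₂ ▸ (hdisj _ m₁).symm
    · exact hP3 _ m₁ _ m₂ hne
  · rw [Finset.card_insert_of_notMem hTP, ← Finset.sum_sdiff hTJ]
    push_cast
    linarith

/-! ### Product densities and random clustering of unit vectors -/

/-- In the `m`-fold tensor power the product densities of two nonnegative unit vectors with inner
product `ρ` have Hellinger affinity `ρ ^ m`. -/
theorem sum_prod_mul_prod {I : Type*} [Fintype I] [DecidableEq I] (m : ℕ) (a b : I → ℝ) :
    ∑ ω : Fin m → I, (∏ j, a (ω j)) * ∏ j, b (ω j) = (∑ i, a i * b i) ^ m := by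
  simp_rw [← Finset.prod_mul_distrib]
  rw [← Fintype.piFinset_univ, ← Finset.prod_univ_sum (fun _ => Finset.univ) fun _ i => a i * b i]
  simp

/-- Factor A² - B² = (A - B)(A + B) and apply Cauchy–Schwarz: the squared norms of the factors are 2
∓ 2ρ^m, where ρ = ⟨a, b⟩. Bernoulli's inequality 1 - ρ^m ≤ m(1 - ρ) finishes, since ‖a - b‖² = 2 -
2ρ. -/
theorem sum_abs_sq_prod_sub_le {I : Type*} [Fintype I] [DecidableEq I] (m : ℕ) (a b : I → ℝ)
    (ha : ∀ i, 0 ≤ a i) (hb : ∀ i, 0 ≤ b i) (ha1 : ∑ i, a i * a i = 1)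
    (hb1 : ∑ i, b i * b i = 1) :
    ∑ ω : Fin m → I, |(∏ j, a (ω j)) ^ 2 - (∏ j, b (ω j)) ^ 2| ≤
      2 * √m * √(∑ i, (a i - b i) ^ 2) := by
  set ρ := ∑ i, a i * b i with hρ
  have hρ0 : 0 ≤ ρ := Finset.sum_nonneg fun i _ => mul_nonneg (ha i) (hb i)
  have hsq : ∑ i, (a i - b i) ^ 2 = 2 - 2 * ρ := by
    have : ∀ i, (a i - b i) ^ 2 = a i * a i + b i * b i - 2 * (a i * b i) := fun i => by ring
    simp only [this, Finset.sum_sub_distrib, Finset.sum_add_distrib, ← Finset.mul_sum, ha1, hb1]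
    ring
  have hρ1 : ρ ≤ 1 := by
    have : 0 ≤ ∑ i, (a i - b i) ^ 2 := Finset.sum_nonneg fun i _ => sq_nonneg _
    linarith
  have haa := sum_prod_mul_prod m a a
  have hbb := sum_prod_mul_prod m b b
  have hab := sum_prod_mul_prod m a b
  rw [ha1, one_pow] at haa
  rw [hb1, one_pow] at hbb
  rw [← hρ] at hab
  set A : (Fin m → I) → ℝ := fun ω => ∏ j, a (ω j)
  set B : (Fin m → I) → ℝ := fun ω => ∏ j, b (ω j)
  have hbern : 1 - ρ ^ m ≤ m * (1 - ρ) := by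
    have := one_add_mul_le_pow (show -2 ≤ ρ - 1 by linarith) m
    rw [add_sub_cancel] at this
    linarith
  have hpow1 : ρ ^ m ≤ 1 := pow_le_one₀ hρ0 hρ1
  have hfac : ∀ ω, |A ω ^ 2 - B ω ^ 2| = |A ω - B ω| * |A ω + B ω| := fun ω => by
    rw [← abs_mul]; ring_nf
  have hcs := Finset.sum_mul_sq_le_sq_mul_sq Finset.univ (fun ω => |A ω - B ω|)
    fun ω => |A ω + B ω|
  simp only [sq_abs] at hcs
  have h1 : ∑ ω, (A ω - B ω) ^ 2 = 2 - 2 * ρ ^ m := by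
    have : ∀ ω, (A ω - B ω) ^ 2 = A ω * A ω + B ω * B ω - 2 * (A ω * B ω) := fun ω => by ring
    simp only [this, Finset.sum_sub_distrib, Finset.sum_add_distrib, ← Finset.mul_sum]
    rw [haa, hbb, hab]; ring
  have h2 : ∑ ω, (A ω + B ω) ^ 2 = 2 + 2 * ρ ^ m := by
    have : ∀ ω, (A ω + B ω) ^ 2 = A ω * A ω + B ω * B ω + 2 * (A ω * B ω) := fun ω => by ring
    simp only [this, Finset.sum_add_distrib, ← Finset.mul_sum]
    rw [haa, hbb, hab]; ring
  rw [h1, h2] at hcs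
  simp only [← hfac] at hcs
  change ∑ ω, |A ω ^ 2 - B ω ^ 2| ≤ _
  rw [hsq, mul_assoc, ← Real.sqrt_mul (by positivity)]
  have h4 : (2 : ℝ) = √4 := by
    rw [show (4 : ℝ) = 2 ^ 2 by norm_num, Real.sqrt_sq (by norm_num)]
  rw [h4, ← Real.sqrt_mul (by norm_num)]
  refine Real.le_sqrt_of_sq_le (hcs.trans ?_)
  have := mul_nonneg (Nat.cast_nonneg (α := ℝ) m) (sub_nonneg.2 hρ1)
  rw [← h4]
  nlinarith [pow_nonneg hρ0 m]

/-- The minimum of two squares is at most the product of the nonnegative bases, so the overlap is at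
most ρ^m = (1 - ‖a - b‖²/2)^m. -/
theorem sum_min_sq_prod_le {I : Type*} [Fintype I] [DecidableEq I] (m : ℕ) (a b : I → ℝ)
    (ha : ∀ i, 0 ≤ a i) (hb : ∀ i, 0 ≤ b i) (ha1 : ∑ i, a i * a i = 1)
    (hb1 : ∑ i, b i * b i = 1) :
    ∑ ω : Fin m → I, min ((∏ j, a (ω j)) ^ 2) ((∏ j, b (ω j)) ^ 2) ≤
      Real.exp (-(m * (∑ i, (a i - b i) ^ 2) / 2)) := by
  set ρ := ∑ i, a i * b i with hρ
  have hρ0 : 0 ≤ ρ := Finset.sum_nonneg fun i _ => mul_nonneg (ha i) (hb i)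
  have hsq : ∑ i, (a i - b i) ^ 2 = 2 - 2 * ρ := by
    have : ∀ i, (a i - b i) ^ 2 = a i * a i + b i * b i - 2 * (a i * b i) := fun i => by ring
    simp only [this, Finset.sum_sub_distrib, Finset.sum_add_distrib, ← Finset.mul_sum, ha1, hb1]
    ring
  calc ∑ ω : Fin m → I, min ((∏ j, a (ω j)) ^ 2) ((∏ j, b (ω j)) ^ 2)
      ≤ ∑ ω : Fin m → I, (∏ j, a (ω j)) * ∏ j, b (ω j) := by
        refine Finset.sum_le_sum fun ω _ => ?_
        have h1 : 0 ≤ ∏ j, a (ω j) := Finset.prod_nonneg fun j _ => ha _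
        have h2 : 0 ≤ ∏ j, b (ω j) := Finset.prod_nonneg fun j _ => hb _
        rcases le_total (∏ j, a (ω j)) (∏ j, b (ω j)) with h | h
        · exact (min_le_left _ _).trans (by nlinarith)
        · exact (min_le_right _ _).trans (by nlinarith)
    _ = ρ ^ m := sum_prod_mul_prod m a b
    _ ≤ Real.exp (ρ - 1) ^ m :=
        pow_le_pow_left₀ hρ0 (by linarith [Real.add_one_le_exp (ρ - 1)]) m
    _ = _ := by
        rw [← Real.exp_nat_mul, hsq]; ring_nf

/-- The positive and negative parts of the coordinates of a vector. -/
noncomputable def signParts {k : ℕ} (x : EuclideanSpace ℝ (Fin k)) (i : Fin k × Bool) : ℝ :=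
  max (if i.2 then x i.1 else -x i.1) 0

theorem signParts_nonneg {k : ℕ} (x : EuclideanSpace ℝ (Fin k)) (i) : 0 ≤ signParts x i :=
  le_max_right _ _

theorem sum_signParts_sq {k : ℕ} (x : EuclideanSpace ℝ (Fin k)) :
    ∑ i, signParts x i * signParts x i = ‖x‖ ^ 2 := by
  rw [EuclideanSpace.norm_sq_eq, Fintype.sum_prod_type]
  refine Finset.sum_congr rfl fun i _ => ?_
  simp only [signParts, Fintype.sum_bool, if_true, Real.norm_eq_abs, sq_abs]
  rcases le_total 0 (x i) with h | h
  · simp [h]; ring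
  · simp [h]; ring

theorem sum_signParts_sub_sq_le {k : ℕ} (x y : EuclideanSpace ℝ (Fin k)) :
    ∑ i, (signParts x i - signParts y i) ^ 2 ≤ ‖x - y‖ ^ 2 := by
  rw [EuclideanSpace.norm_sq_eq, Fintype.sum_prod_type]
  refine Finset.sum_le_sum fun i _ => ?_
  simp only [signParts, Fintype.sum_bool, if_true, Real.norm_eq_abs, sq_abs, PiLp.sub_apply]
  rcases le_total 0 (x i) with h | h <;> rcases le_total 0 (y i) with h' | h' <;>
    simp [h, h'] <;>
    first
      | nlinarith [mul_nonneg h (neg_nonneg.2 h')]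
      | nlinarith [mul_nonneg (neg_nonneg.2 h) h']
      | nlinarith

/-- Only coordinates of opposite sign lose anything: there the parts contribute x² + y², which is at
least (x - y)²/2. -/
theorem le_sum_signParts_sub_sq {k : ℕ} (x y : EuclideanSpace ℝ (Fin k)) :
    ‖x - y‖ ^ 2 / 2 ≤ ∑ i, (signParts x i - signParts y i) ^ 2 := by
  rw [EuclideanSpace.norm_sq_eq, Fintype.sum_prod_type, Finset.sum_div]
  refine Finset.sum_le_sum fun i _ => ?_
  simp only [signParts, Fintype.sum_bool, if_true, Real.norm_eq_abs, sq_abs, PiLp.sub_apply]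
  rcases le_total 0 (x i) with h | h <;> rcases le_total 0 (y i) with h' | h' <;>
    simp [h, h'] <;> nlinarith [sq_nonneg (x i + y i), sq_nonneg (x i - y i)]

/-- Unit vectors can be randomly clustered so that the clusters have diameter about
`√(log (1 / ε) / m)` and nearby vectors are rarely separated. -/
theorem exists_random_clustering {V : Type*} [Fintype V] (v₀ : V) {k : ℕ}
    (x : V → EuclideanSpace ℝ (Fin k)) (hx : ∀ v, ‖x v‖ = 1) (m : ℕ) {ε : ℝ} (hε : 0 < ε) :
    ∃ (Θ : Type) (_ : Fintype Θ) (q : Θ → ℝ) (l : Θ → V → ℕ), (∀ θ, 0 ≤ q θ) ∧ ∑ θ, q θ = 1 ∧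
      (∀ u v, ∑ θ, q θ * (if l θ u = l θ v then 0 else 1) ≤ 2 * √m * ‖x u - x v‖) ∧
      ∀ u v, ∑ θ, q θ * (if l θ u = l θ v then 1 else 0) ≤
        Real.exp (-(m * ‖x u - x v‖ ^ 2 / 4)) + ε := by
  have hunit : ∀ v, ∑ i, signParts (x v) i * signParts (x v) i = 1 := fun v => by
    rw [sum_signParts_sq, hx, one_pow]
  obtain ⟨Θ, i, q, l, hq, hq1, hsep, hsame⟩ := exists_correlated_labels v₀
    (fun v (ω : Fin m → Fin k × Bool) => (∏ j, signParts (x v) (ω j)) ^ 2)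
    (fun v ω => sq_nonneg _) (fun v => by
      simp only [sq]
      rw [sum_prod_mul_prod, hunit, one_pow]) hε
  refine ⟨Θ, i, q, l, hq, hq1, fun u v => ?_, fun u v => ?_⟩
  · refine (hsep u v).trans ((sum_abs_sq_prod_sub_le m _ _ (signParts_nonneg _)
      (signParts_nonneg _) (hunit u) (hunit v)).trans ?_)
    gcongr
    exact Real.sqrt_le_iff.2 ⟨norm_nonneg _, sum_signParts_sub_sq_le _ _⟩
  · refine (hsame u v).trans (add_le_add_left ((sum_min_sq_prod_le m _ _ (signParts_nonneg _)
      (signParts_nonneg _) (hunit u) (hunit v)).trans ?_) _)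
    rw [Real.exp_le_exp, neg_le_neg_iff]
    have := mul_le_mul_of_nonneg_left (le_sum_signParts_sub_sq (x u) (x v))
      (Nat.cast_nonneg (α := ℝ) m)
    linarith

/-! ### Edge sums as matrix sums, and the sweep cut -/

namespace WeightedGraph

section Basic

variable {V : Type*} [DecidableEq V] (G : WeightedGraph V)

theorem adjacency_apply (u v : V) :
    G.adjacency u v = if s(u, v) ∈ G.edges then G.weight s(u, v) else 0 := rfl

theorem adjacency_nonneg (u v : V) : 0 ≤ G.adjacency u v := by
  rw [adjacency_apply]
  split_ifs with h
  exacts [(G.weight_pos _ h).le, le_rfl]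

theorem adjacency_comm (u v : V) : G.adjacency u v = G.adjacency v u := by
  simp only [adjacency_apply, Sym2.eq_swap (a := u)]

variable [Fintype V]

theorem vertexWeight_eq (v : V) : G.vertexWeight v = ∑ u, G.adjacency v u := by
  simp only [vertexWeight, adjacency_apply, Finset.sum_filter, Sym2.eq_swap (b := v)]

/-- A proper edge comes from two ordered pairs but a self-loop from only one, hence the vanishing of
h on the diagonal. -/
theorem sum_adjacency_mul (h : Sym2 V → ℝ) (hd : ∀ v, h s(v, v) = 0) :
    ∑ u, ∑ v, G.adjacency u v * h s(u, v) = 2 * ∑ e ∈ G.edges, G.weight e * h e := by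
  set g : Sym2 V → ℝ := fun e => if e ∈ G.edges then G.weight e * h e else 0 with hg
  have h1 : ∀ u v, G.adjacency u v * h s(u, v) = g s(u, v) := fun u v => by
    simp only [adjacency_apply, hg, ite_mul, zero_mul]
  simp only [h1]
  rw [← Fintype.sum_prod_type' (f := fun u v => g s(u, v)),
    ← Finset.sum_fiberwise Finset.univ (fun x : V × V => s(x.1, x.2))]
  have h2 : ∀ e : Sym2 V, ∑ x : V × V with s(x.1, x.2) = e, g s(x.1, x.2) = 2 * g e := by
    intro e
    have h3 : ∑ x : V × V with s(x.1, x.2) = e, g s(x.1, x.2) =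
        ∑ x : V × V with s(x.1, x.2) = e, g e :=
      Finset.sum_congr rfl fun x hx => by rw [(Finset.mem_filter.1 hx).2]
    rw [h3]
    induction e using Sym2.ind with
    | _ a b =>
      by_cases hab : a = b
      · subst hab
        simp [hg, hd]
      · have : ({x : V × V | s(x.1, x.2) = s(a, b)} : Finset (V × V)) = {(a, b), (b, a)} := by
          ext ⟨x, y⟩
          simp
        rw [this, Finset.sum_pair (by simp [hab])]
        ring
  simp only [h2]
  rw [← Finset.mul_sum]
  simp [hg, Finset.sum_ite_mem]

theorem two_mul_energy (f : V → ℝ) :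
    2 * G.energy f = ∑ u, ∑ v, G.adjacency u v * (f u - f v) ^ 2 := by
  rw [energy, ← sum_adjacency_mul _ _ (by simp)]
  simp

theorem two_mul_cut (S : Finset V) :
    2 * ∑ e ∈ G.cut S, G.weight e =
      ∑ u, ∑ v, G.adjacency u v * |(if u ∈ S then 1 else 0) - (if v ∈ S then 1 else 0)| := by
  set h : Sym2 V → ℝ := Sym2.lift ⟨fun u v =>
    |(if u ∈ S then 1 else 0) - (if v ∈ S then 1 else 0)|, fun u v => abs_sub_comm _ _⟩ with hh
  have h1 : ∀ u v, |(if u ∈ S then (1 : ℝ) else 0) - (if v ∈ S then 1 else 0)| = h s(u, v) :=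
    fun u v => by simp [hh]
  simp only [h1]
  rw [sum_adjacency_mul _ _ (by simp [hh]), cut, Finset.sum_filter]
  congr 1
  refine Finset.sum_congr rfl fun e _ => ?_
  induction e using Sym2.ind with
  | _ a b =>
    have : (∃ u v, u ∈ S ∧ v ∉ S ∧ s(a, b) = s(u, v)) ↔ (a ∈ S ∧ b ∉ S) ∨ (b ∈ S ∧ a ∉ S) := by
      constructor
      · rintro ⟨u, v, hu, hv, he⟩
        rcases Sym2.eq_iff.1 he with ⟨rfl, rfl⟩ | ⟨rfl, rfl⟩
        exacts [Or.inl ⟨hu, hv⟩, Or.inr ⟨hu, hv⟩]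
      · rintro (⟨ha, hb⟩ | ⟨hb, ha⟩)
        exacts [⟨a, b, ha, hb, rfl⟩, ⟨b, a, hb, ha, Sym2.eq_swap⟩]
    rw [if_congr this rfl rfl, ← h1]
    by_cases ha : a ∈ S <;> by_cases hb : b ∈ S <;> simp [ha, hb]

theorem expansion_univ : G.expansion Finset.univ = 0 := by
  simp [expansion, cut]

/-- Cheeger's inequality in its `ℓ¹` form: some superlevel set of a nonnegative function `g` has
expansion at most the `ℓ¹` Rayleigh quotient of `g`. -/
theorem exists_expansion_le (hw : ∀ v, 0 < G.vertexWeight v) (g : V → ℝ) (hg : ∀ v, 0 ≤ g v)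
    (hpos : 0 < ∑ v, G.vertexWeight v * g v) :
    ∃ S : Finset V, S.Nonempty ∧ (∀ v ∈ S, 0 < g v) ∧
      G.expansion S * (2 * ∑ v, G.vertexWeight v * g v) ≤
        ∑ u, ∑ v, G.adjacency u v * |g u - g v| := by
  set s : Finset ℝ := Finset.univ.image g with hs
  have hmem : ∀ v, g v ∈ s := fun v => Finset.mem_image_of_mem _ (Finset.mem_univ _)
  have hs0 : ∀ t ∈ s, 0 ≤ t := fun t ht => by
    obtain ⟨v, -, rfl⟩ := Finset.mem_image.1 ht
    exact hg v
  obtain ⟨q, hq, hqs⟩ := exists_layer_weights s hs0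
  set S : ℝ → Finset V := fun t => {v | t ≤ g v} with hS
  have hlayer : ∀ v, ∑ t ∈ s, q t * (if v ∈ S t then 1 else 0) = g v := fun v => by
    rw [← hqs _ (hmem v), Finset.sum_filter]
    simp [hS]
  have habs : ∀ u v, ∑ t ∈ s, q t * |(if u ∈ S t then 1 else 0) - (if v ∈ S t then 1 else 0)| =
      |g u - g v| := by
    have key : ∀ u v, g u ≤ g v → ∑ t ∈ s, q t *
        |(if u ∈ S t then 1 else 0) - (if v ∈ S t then 1 else 0)| = |g u - g v| := by
      intro u v huv
      rw [abs_of_nonpos (by linarith), neg_sub, ← hlayer u, ← hlayer v, ← Finset.sum_sub_distrib]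
      refine Finset.sum_congr rfl fun t _ => ?_
      by_cases h : t ≤ g u
      · simp [hS, h, h.trans huv]
      · by_cases h' : t ≤ g v <;> simp [hS, h, h']
    intro u v
    rcases le_total (g u) (g v) with h | h
    · exact key u v h
    · rw [abs_sub_comm, ← key v u h]
      simp only [abs_sub_comm]
  have hcut : ∑ t ∈ s, q t * (2 * ∑ e ∈ G.cut (S t), G.weight e) =
      ∑ u, ∑ v, G.adjacency u v * |g u - g v| := by
    simp only [two_mul_cut, ← habs]
    simp only [Finset.mul_sum]
    rw [Finset.sum_comm]
    refine Finset.sum_congr rfl fun u _ => ?_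
    rw [Finset.sum_comm]
    exact Finset.sum_congr rfl fun v _ => Finset.sum_congr rfl fun t _ => by ring
  have hset : ∑ t ∈ s, q t * G.setWeight (S t) = ∑ v, G.vertexWeight v * g v := by
    have : ∀ t, G.setWeight (S t) = ∑ v, G.vertexWeight v * (if v ∈ S t then 1 else 0) :=
      fun t => by simp [setWeight]
    simp only [this, ← hlayer, Finset.mul_sum]
    rw [Finset.sum_comm]
    exact Finset.sum_congr rfl fun v _ => Finset.sum_congr rfl fun t _ => by ring
  -- Level 0 has weight zero, so the superlevel sets that count lie in the support of g.
  have hq0 : ∀ t ∈ s, t ≤ 0 → q t = 0 := by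
    intro t ht h
    have h0 := le_antisymm h (hs0 t ht)
    subst h0
    have h1 := hqs 0 ht
    exact (Finset.sum_eq_zero_iff_of_nonneg fun t _ => hq t).1 h1 0 (by simp [ht])
  -- Averaging over levels: cut weight and set weight average to the two sides of the ℓ¹ quotient,
  -- so not every level can be strictly worse than the average.
  by_contra! hcon
  have hlt : ∑ t ∈ s, q t * ((∑ u, ∑ v, G.adjacency u v * |g u - g v|) * G.setWeight (S t)) <
      ∑ t ∈ s, q t * ((2 * ∑ e ∈ G.cut (S t), G.weight e) * ∑ v, G.vertexWeight v * g v) := by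
    have hstrict : ∀ t ∈ s, 0 < q t →
        (∑ u, ∑ v, G.adjacency u v * |g u - g v|) * G.setWeight (S t) <
        (2 * ∑ e ∈ G.cut (S t), G.weight e) * ∑ v, G.vertexWeight v * g v := by
      intro t ht hqt
      have ht0 : 0 < t := by
        by_contra! h
        exact hqt.ne' (hq0 t ht h)
      obtain ⟨v, -, hv⟩ := Finset.mem_image.1 ht
      have hne : (S t).Nonempty := ⟨v, by simp [hS, hv]⟩
      have hSw : 0 < G.setWeight (S t) := Finset.sum_pos (fun v _ => hw v) hne
      have h := hcon (S t) hne fun v hv => ht0.trans_le (by simpa [hS] using hv)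
      have h2 := mul_lt_mul_of_pos_right h hSw
      rw [expansion] at h2
      refine h2.trans_eq ?_
      field_simp
    refine Finset.sum_lt_sum (fun t ht => ?_) ?_
    · rcases (hq t).eq_or_lt with h | h
      · simp [← h]
      · exact mul_le_mul_of_nonneg_left (hstrict t ht h).le h.le
    · by_contra! h
      have h0 : ∑ t ∈ s, q t * G.setWeight (S t) = 0 := Finset.sum_eq_zero fun t ht => by
        rcases (hq t).eq_or_lt with h' | h'
        · simp [← h']
        · exact absurd (mul_lt_mul_of_pos_left (hstrict t ht h') h') (not_lt.2 (h t ht))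
      linarith
  have e1 : ∑ t ∈ s, q t * ((∑ u, ∑ v, G.adjacency u v * |g u - g v|) * G.setWeight (S t)) =
      (∑ u, ∑ v, G.adjacency u v * |g u - g v|) * ∑ v, G.vertexWeight v * g v := by
    rw [← hset, Finset.mul_sum]
    exact Finset.sum_congr rfl fun t _ => by ring
  have e2 : ∑ t ∈ s, q t * ((2 * ∑ e ∈ G.cut (S t), G.weight e) *
      ∑ v, G.vertexWeight v * g v) =
      (∑ u, ∑ v, G.adjacency u v * |g u - g v|) * ∑ v, G.vertexWeight v * g v := by
    rw [← hcut, Finset.sum_mul]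
    exact Finset.sum_congr rfl fun t _ => by ring
  rw [e1, e2] at hlt
  exact hlt.false

end Basic

end WeightedGraph

/-! ### From labels to groups -/

/-- If every vertex has little mass near it, and few pairs of far vertices share a label, then the
label classes can be grouped into almost `k` disjoint groups of substantial mass. -/
theorem exists_label_groups {V : Type*} [Fintype V] (μ : V → ℝ) (hμ : ∀ v, 0 ≤ μ v)
    (far : V → V → Prop) [DecidableRel far] {η κ : ℝ} (hη : 0 < η)
    (htot : ∑ v, μ v = κ)
    (hnear : ∀ v, 0 < μ v → ∑ u, μ u * (if far v u then 0 else 1) ≤ 1 + η / 2) (l : V → ℕ)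
    (hfar : ∑ v, ∑ u, μ v * μ u * (if far v u then 1 else 0) * (if l v = l u then 1 else 0) ≤
      η / 2 * (η * κ)) :
    ∃ P : Finset (Finset ℕ), (∀ T ∈ P, 1 / 8 ≤ ∑ v, μ v * (if l v ∈ T then 1 else 0)) ∧
      (∀ T ∈ P, ∀ T' ∈ P, T ≠ T' → Disjoint T T') ∧ κ * (1 - η) ≤ (1 + η) * P.card + 1 / 8 := by
  classical
  set M : ℕ → ℝ := fun i => ∑ v, μ v * (if l v = i then 1 else 0) with hM
  have hM0 : ∀ i, 0 ≤ M i := fun i => Finset.sum_nonneg fun v _ =>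
    mul_nonneg (hμ v) (by split_ifs <;> norm_num)
  have hMT : ∀ T : Finset ℕ, ∑ i ∈ T, M i = ∑ v, μ v * (if l v ∈ T then 1 else 0) := fun T => by
    simp only [hM]
    rw [Finset.sum_comm]
    refine Finset.sum_congr rfl fun v _ => ?_
    rw [← Finset.mul_sum]
    simp
  set J := Finset.univ.image l with hJ
  have hJtot : ∑ i ∈ J, M i = κ := by
    rw [hMT, ← htot]
    exact Finset.sum_congr rfl fun v _ => by simp [hJ]
  obtain ⟨P, -, hP2, hP3, hP4⟩ := exists_grouping M hM0 (c := 1 + η) (β := 1 / 8) (by norm_num)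
    (by linarith) (J.filter fun i => M i ≤ 1 + η) (by simp)
  refine ⟨P, fun T hT => (hMT T) ▸ hP2 T hT, hP3, ?_⟩
  -- In a class heavier than 1 + η, each vertex of positive mass sees at most 1 + η/2 near it, hence
  -- at least η/2 of far classmates. The bound on far pairs thus limits the total mass of such
  -- classes.
  have hbad : ∑ i ∈ J with ¬ M i ≤ 1 + η, M i ≤ η * κ := by
    have hpair : ∀ i, ¬ M i ≤ 1 + η → η / 2 * M i ≤ ∑ v, ∑ u, μ v * μ u *
        (if far v u then 1 else 0) * ((if l v = i then 1 else 0) * (if l u = i then 1 else 0)) := by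
      intro i hi
      push Not at hi
      rw [hM, Finset.mul_sum]
      refine Finset.sum_le_sum fun v _ => ?_
      by_cases hv : l v = i
      swap
      · simp [hv]
      rcases (hμ v).eq_or_lt with h0 | h0
      · simp [← h0]
      have h1 := hnear v h0
      have h2 : η / 2 ≤ ∑ u, μ u * (if far v u then 1 else 0) * (if l u = i then 1 else 0) := by
        have h3 : M i ≤ ∑ u, μ u * (if far v u then 0 else 1) +
            ∑ u, μ u * (if far v u then 1 else 0) * (if l u = i then 1 else 0) := by
          rw [← Finset.sum_add_distrib]
          refine Finset.sum_le_sum fun u _ => ?_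
          by_cases h : far v u <;> by_cases h' : l u = i <;> simp [h, h', hμ]
        linarith
      have h4 := mul_le_mul_of_nonneg_left h2 h0.le
      rw [Finset.mul_sum] at h4
      simp only [hv, if_true, one_mul, mul_one]
      rw [mul_comm]
      refine h4.trans_eq (Finset.sum_congr rfl fun u _ => by ring)
    have hsum : ∑ i ∈ J with ¬ M i ≤ 1 + η, η / 2 * M i ≤ η / 2 * (η * κ) := by
      refine le_trans ?_ hfar
      refine (Finset.sum_le_sum fun i hi => hpair i (Finset.mem_filter.1 hi).2).trans ?_
      rw [Finset.sum_comm]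
      refine Finset.sum_le_sum fun v _ => ?_
      rw [Finset.sum_comm]
      refine Finset.sum_le_sum fun u _ => ?_
      rw [← Finset.mul_sum]
      refine mul_le_mul_of_nonneg_left ?_
        (mul_nonneg (mul_nonneg (hμ v) (hμ u)) (by split_ifs <;> norm_num))
      by_cases h : l v = l u
      · simp only [h, ← ite_and, and_self, mul_ite, mul_one, mul_zero, if_true]
        rw [Finset.sum_ite_eq]
        split_ifs <;> norm_num
      · rw [if_neg h]
        refine (Finset.sum_eq_zero fun i _ => ?_).le
        by_cases h1 : l v = i
        · have : ¬ l u = i := fun h2 => h (h1.trans h2.symm)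
          simp [this]
        · simp [h1]
    rw [← Finset.mul_sum] at hsum
    exact le_of_mul_le_mul_left hsum (by linarith)
  have := Finset.sum_filter_add_sum_filter_not J (fun i => M i ≤ 1 + η) M
  linarith

theorem sum_ite_mem_le {ι : Type*} [DecidableEq ι] {P : Finset (Finset ι)}
    (hP : ∀ T ∈ P, ∀ T' ∈ P, T ≠ T' → Disjoint T T') (i : ι) {a : ℝ} (ha : 0 ≤ a) :
    ∑ T ∈ P, (if i ∈ T then a else 0) ≤ a := by
  rw [← Finset.sum_filter, Finset.sum_const, nsmul_eq_mul]
  have : (P.filter fun T => i ∈ T).card ≤ 1 := by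
    refine Finset.card_le_one.2 fun T hT T' hT' => ?_
    rw [Finset.mem_filter] at hT hT'
    by_contra hne
    exact Finset.disjoint_left.1 (hP T hT.1 T' hT'.1 hne) hT.2 hT'.2
  have : ((P.filter fun T => i ∈ T).card : ℝ) ≤ 1 := by exact_mod_cast this
  nlinarith

/-- Equal labels lie in at most one common group, at cost |a - b|. Distinct labels cost at most a +
b = |a - b| + 2 min(a, b), so separation adds only the second term. -/
theorem sum_abs_localized_sub_le {P : Finset (Finset ℕ)}
    (hP : ∀ T ∈ P, ∀ T' ∈ P, T ≠ T' → Disjoint T T') (i j : ℕ) {a b : ℝ} (ha : 0 ≤ a)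
    (hb : 0 ≤ b) :
    ∑ T ∈ P, |(if i ∈ T then a else 0) - (if j ∈ T then b else 0)| ≤
      |a - b| + 2 * min a b * (if i = j then 0 else 1) := by
  by_cases h : i = j
  · subst h
    simp only [if_true, mul_zero, add_zero]
    refine le_trans (Finset.sum_le_sum fun T _ => ?_) (sum_ite_mem_le hP i (abs_nonneg (a - b)))
    split_ifs <;> simp
  · have h1 : |a - b| + 2 * min a b * (if i = j then 0 else 1) = a + b := by
      rw [if_neg h]
      rcases le_total a b with h | h
      · rw [min_eq_left h, abs_of_nonpos (by linarith)]; ring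
      · rw [min_eq_right h, abs_of_nonneg (by linarith)]; ring
    rw [h1]
    refine le_trans (Finset.sum_le_sum (g := fun T => (if i ∈ T then a else 0) +
      (if j ∈ T then b else 0)) fun T _ => ?_) ?_
    · split_ifs <;> rw [abs_le] <;> constructor <;> linarith
    · rw [Finset.sum_add_distrib]
      exact add_le_add (sum_ite_mem_le hP i ha) (sum_ite_mem_le hP j hb)

/-! ### Isotropy and radial projection -/

open scoped InnerProductSpace in
/-- In isotropic position, little mass projects radially near any given direction. -/
theorem sum_near_le_of_isotropic {V : Type*} [Fintype V] {k : ℕ} (w : V → ℝ) (hw : ∀ v, 0 ≤ w v)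
    (F y : V → EuclideanSpace ℝ (Fin k)) (hy : ∀ v, ‖y v‖ = 1) (hF : ∀ v, F v = ‖F v‖ • y v)
    (hiso : ∀ x : EuclideanSpace ℝ (Fin k), ∑ v, w v * ⟪F v, x⟫_ℝ ^ 2 = ‖x‖ ^ 2)
    {Δ : ℝ} (v : V) :
    (1 - Δ) * ∑ u, w u * ‖F u‖ ^ 2 * (if Δ ≤ ‖y v - y u‖ ^ 2 then 0 else 1) ≤ 1 := by
  have h1 := hiso (y v)
  rw [hy, one_pow] at h1
  rw [Finset.mul_sum]
  refine (Finset.sum_le_sum fun u _ => ?_).trans h1.le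
  have hFu : ⟪F u, y v⟫_ℝ = ‖F u‖ * ⟪y v, y u⟫_ℝ := by
    conv_lhs => rw [hF u, real_inner_smul_left, real_inner_comm]
  rw [hFu]
  split_ifs with h
  · rw [mul_zero, mul_zero]
    exact mul_nonneg (hw u) (sq_nonneg _)
  · have h2 := norm_sub_sq_real (y v) (y u)
    rw [hy, hy] at h2
    -- With t the inner product, nearness gives t > 1 - Δ/2, and t² ≥ 2t - 1.
    have h3 : 1 - Δ ≤ ⟪y v, y u⟫_ℝ ^ 2 := by nlinarith
    have h4 := mul_le_mul_of_nonneg_left h3 (mul_nonneg (hw u) (sq_nonneg ‖F u‖))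
    linarith

/-- The radial projection contracts, once scaled by the smaller of the two norms. -/
theorem min_norm_mul_norm_sub_le {E : Type*} [NormedAddCommGroup E] [InnerProductSpace ℝ E]
    (a b y z : E) (hy : ‖y‖ = 1) (hz : ‖z‖ = 1) (ha : a = ‖a‖ • y) (hb : b = ‖b‖ • z) :
    min ‖a‖ ‖b‖ * ‖y - z‖ ≤ ‖a - b‖ := by
  have key : ∀ r s : ℝ, ∀ y z : E, ‖y‖ = 1 → ‖z‖ = 1 → 0 ≤ r → r ≤ s →
      r * ‖y - z‖ ≤ ‖r • y - s • z‖ := by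
    intro r s y z hy hz hr hrs
    refine le_of_sq_le_sq ?_ (norm_nonneg _)
    rw [mul_pow, norm_sub_sq_real, norm_sub_sq_real, real_inner_smul_left, real_inner_smul_right,
      norm_smul, norm_smul, hy, hz, Real.norm_of_nonneg hr, Real.norm_of_nonneg (hr.trans hrs)]
    have h1 : inner ℝ y z ≤ 1 := by
      have := real_inner_le_norm y z
      rwa [hy, hz, one_mul] at this
    -- The difference of the two squares is (s - r)² + 2r(s - r)(1 - ⟨y, z⟩).
    nlinarith [mul_nonneg (mul_nonneg hr (sub_nonneg.2 hrs)) (sub_nonneg.2 h1),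
      sq_nonneg (s - r)]
  conv_rhs => rw [ha, hb]
  rcases le_total ‖a‖ ‖b‖ with h | h
  · rw [min_eq_left h]
    exact key _ _ y z hy hz (norm_nonneg _) h
  · rw [min_eq_right h, norm_sub_rev y, norm_sub_rev (‖a‖ • y)]
    exact key _ _ z y hz hy (norm_nonneg _) h

/-- The zero vector has no direction of its own; since its mass is zero, any unit vector will do. -/
theorem exists_unit_direction {k : ℕ} (hk : 0 < k) (a : EuclideanSpace ℝ (Fin k)) :
    ∃ y : EuclideanSpace ℝ (Fin k), ‖y‖ = 1 ∧ a = ‖a‖ • y := by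
  by_cases h : a = 0
  · exact ⟨EuclideanSpace.single ⟨0, hk⟩ 1, by simp, by simp [h]⟩
  · have : ‖a‖ ≠ 0 := norm_ne_zero_iff.2 h
    exact ⟨‖a‖⁻¹ • a, by rw [norm_smul, norm_inv, norm_norm, inv_mul_cancel₀ this],
      by rw [smul_smul, mul_inv_cancel₀ this, one_smul]⟩

/-! ### The spectral embedding and its energy -/

namespace WeightedGraph

variable {V : Type*}

/-- The map `v ↦ (f₁(v), …, f_k(v))`. -/
noncomputable def embedding {k : ℕ} (f : Fin k → V → ℝ) (v : V) : EuclideanSpace ℝ (Fin k) :=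
  WithLp.toLp 2 fun i => f i v

variable {k : ℕ} {f : Fin k → V → ℝ}

theorem norm_embedding_sq (v : V) : ‖embedding f v‖ ^ 2 = ∑ i, f i v ^ 2 := by
  simp [EuclideanSpace.norm_sq_eq, embedding]

variable [Fintype V] [DecidableEq V] {G : WeightedGraph V}

theorem IsOrthonormalSystem.isotropic (hf : G.IsOrthonormalSystem f)
    (x : EuclideanSpace ℝ (Fin k)) :
    ∑ v, G.vertexWeight v * inner ℝ (embedding f v) x ^ 2 = ‖x‖ ^ 2 := by
  have h1 : ∀ v, G.vertexWeight v * inner ℝ (embedding f v) x ^ 2 =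
      ∑ i, ∑ j, x i * x j * (G.vertexWeight v * f i v * f j v) := fun v => by
    rw [PiLp.inner_apply, sq, Finset.sum_mul_sum, Finset.mul_sum]
    refine Finset.sum_congr rfl fun i _ => ?_
    rw [Finset.mul_sum]
    refine Finset.sum_congr rfl fun j _ => ?_
    simp [embedding]
    ring
  simp only [h1]
  rw [Finset.sum_comm, EuclideanSpace.norm_sq_eq]
  refine Finset.sum_congr rfl fun i _ => ?_
  rw [Finset.sum_comm]
  simp only [← Finset.mul_sum]
  have h2 : ∀ j, ∑ v, G.vertexWeight v * f i v * f j v = if i = j then 1 else 0 := hf i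
  simp [h2, sq]

theorem IsOrthonormalSystem.sum_sq (hf : G.IsOrthonormalSystem f) :
    ∑ i, ∑ v, G.vertexWeight v * f i v ^ 2 = k := by
  have : ∀ i, ∑ v, G.vertexWeight v * f i v ^ 2 = 1 := fun i => by
    have h := hf i i
    rw [if_pos rfl] at h
    rw [← h, innerW]
    exact Finset.sum_congr rfl fun v _ => by ring
  simp [this]

theorem IsOrthonormalSystem.sum_norm_sq (hf : G.IsOrthonormalSystem f) :
    ∑ v, G.vertexWeight v * ‖embedding f v‖ ^ 2 = k := by
  simp only [norm_embedding_sq, Finset.mul_sum]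
  rw [Finset.sum_comm, hf.sum_sq]

theorem sum_adjacency_mul_norm_sub_sq :
    ∑ u, ∑ v, G.adjacency u v * ‖embedding f u - embedding f v‖ ^ 2 =
      2 * ∑ i, G.energy (f i) := by
  rw [Finset.mul_sum]
  simp only [two_mul_energy, EuclideanSpace.norm_sq_eq, embedding, PiLp.sub_apply,
    Real.norm_eq_abs, sq_abs, Finset.mul_sum]
  rw [Finset.sum_comm' (t' := Finset.univ) (s' := fun _ => Finset.univ) (by simp)]
  rw [Finset.sum_comm]
  simp only [Finset.sum_comm (γ := Fin k)]

theorem IsOrthonormalSystem.sum_energy (hf : G.IsOrthonormalSystem f) (hk : 0 < k) :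
    ∑ i, G.energy (f i) = G.aggregateRayleigh f * k := by
  rw [aggregateRayleigh, hf.sum_sq, div_mul_cancel₀]
  exact_mod_cast hk.ne'

theorem energy_nonneg (f : V → ℝ) : 0 ≤ G.energy f := by
  have h : 0 ≤ 2 * G.energy f := by
    rw [two_mul_energy]
    exact Finset.sum_nonneg fun u _ => Finset.sum_nonneg fun v _ =>
      mul_nonneg (G.adjacency_nonneg u v) (sq_nonneg _)
  linarith

theorem IsOrthonormalSystem.aggregateRayleigh_nonneg (hf : G.IsOrthonormalSystem f) :
    0 ≤ G.aggregateRayleigh f := by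
  rw [aggregateRayleigh, hf.sum_sq]
  exact div_nonneg (Finset.sum_nonneg fun i _ => energy_nonneg _) (Nat.cast_nonneg _)

/-- The `ℓ¹` energy of `‖F‖ ‖F - F'‖` is controlled by the Rayleigh quotient. -/
theorem IsOrthonormalSystem.sum_adjacency_mul_norm_add_mul_norm_sub_le
    (hf : G.IsOrthonormalSystem f) (hk : 0 < k) :
    ∑ u, ∑ v, G.adjacency u v * ((‖embedding f u‖ + ‖embedding f v‖) *
      ‖embedding f u - embedding f v‖) ≤ 3 * k * √(G.aggregateRayleigh f) := by
  have hA : ∀ u v, 0 ≤ G.adjacency u v := G.adjacency_nonneg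
  have hcs := Finset.sum_mul_sq_le_sq_mul_sq (Finset.univ : Finset (V × V))
    (fun x => √(G.adjacency x.1 x.2) * (‖embedding f x.1‖ + ‖embedding f x.2‖))
    (fun x => √(G.adjacency x.1 x.2) * ‖embedding f x.1 - embedding f x.2‖)
  have e0 : ∀ x : V × V, √(G.adjacency x.1 x.2) * (‖embedding f x.1‖ + ‖embedding f x.2‖) *
      (√(G.adjacency x.1 x.2) * ‖embedding f x.1 - embedding f x.2‖) =
      G.adjacency x.1 x.2 * ((‖embedding f x.1‖ + ‖embedding f x.2‖) *
        ‖embedding f x.1 - embedding f x.2‖) := fun x => by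
    have := Real.mul_self_sqrt (hA x.1 x.2)
    linear_combination ((‖embedding f x.1‖ + ‖embedding f x.2‖) *
        ‖embedding f x.1 - embedding f x.2‖) * this
  simp only [e0, mul_pow, Real.sq_sqrt (hA _ _), Fintype.sum_prod_type] at hcs
  rw [sum_adjacency_mul_norm_sub_sq, hf.sum_energy hk] at hcs
  have h1 : ∑ u, ∑ v, G.adjacency u v * (‖embedding f u‖ + ‖embedding f v‖) ^ 2 ≤ 4 * k := by
    have h2 : ∑ u, ∑ v, G.adjacency u v * ‖embedding f u‖ ^ 2 = k := by
      simp only [← Finset.sum_mul, ← vertexWeight_eq, hf.sum_norm_sq]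
    have h3 : ∑ u, ∑ v, G.adjacency u v * ‖embedding f v‖ ^ 2 = k := by
      rw [Finset.sum_comm, ← h2]
      simp only [G.adjacency_comm]
    calc ∑ u, ∑ v, G.adjacency u v * (‖embedding f u‖ + ‖embedding f v‖) ^ 2
        ≤ ∑ u, ∑ v, (2 * (G.adjacency u v * ‖embedding f u‖ ^ 2) +
          2 * (G.adjacency u v * ‖embedding f v‖ ^ 2)) := by
          refine Finset.sum_le_sum fun u _ => Finset.sum_le_sum fun v _ => ?_
          nlinarith [mul_nonneg (hA u v) (sq_nonneg (‖embedding f u‖ - ‖embedding f v‖))]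
      _ = 4 * (k : ℝ) := by
          simp only [Finset.sum_add_distrib, ← Finset.mul_sum, h2, h3]
          ring
  have hR := hf.aggregateRayleigh_nonneg
  refine abs_le_of_sq_le_sq' ?_ (by positivity) |>.2
  have h4 : (0 : ℝ) ≤ 2 * (G.aggregateRayleigh f * k) := by positivity
  -- Cauchy–Schwarz gives 4k · 2kR = 8k²R, rounded up to (3k)²R.
  refine hcs.trans ((mul_le_mul_of_nonneg_right h1 h4).trans ?_)
  rw [mul_pow, Real.sq_sqrt hR]
  nlinarith [mul_nonneg hR (sq_nonneg (k : ℝ))]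

end WeightedGraph

/-! ### Choice of parameters and assembly of the sets -/

/-- The parameters of the random clustering: the number `m` of samples is of order `log k / δ`,
and far vertices are then clustered together with probability at most polynomially small in `k`. -/
theorem exists_sample_size {k : ℕ} (hk : 2 ≤ k) {δ : ℝ} (hδk : 1 / (2 * k) ≤ δ) (hδ1 : δ < 1) :
    ∃ m : ℕ, 1 ≤ m ∧ (m : ℝ) ≤ 45 ^ 2 * (Real.log k / δ) ∧
      Real.exp (-(m * (δ / 32) / 4)) ≤ (δ / 8) ^ 2 / (12 * k) := by
  have hk2 : (2 : ℝ) ≤ k := by exact_mod_cast hk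
  have hk0 : (0 : ℝ) < k := by linarith
  have hδ0 : 0 < δ := lt_of_lt_of_le (by positivity) hδk
  have hL : 0.69 < Real.log k := by
    have h1 := Real.log_le_log (by norm_num) hk2
    have h2 := Real.log_two_gt_d9
    linarith
  have hLδ : 0.69 < Real.log k / δ := by
    rw [lt_div_iff₀ hδ0]
    nlinarith
  -- Since 1920 = 15 · 128, the exponential is at most k^(-15), while δ ≥ 1/(2k) makes the target at
  -- least of order k^(-3). The ceiling is absorbed in 45² = 2025, a square for the sake of later
  -- roots.
  refine ⟨⌈1920 * (Real.log k / δ)⌉₊, ?_, ?_, ?_⟩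
  · exact Nat.one_le_iff_ne_zero.2 (Nat.ceil_pos.2 (by linarith)).ne'
  · have := Nat.ceil_lt_add_one (show 0 ≤ 1920 * (Real.log k / δ) by linarith)
    linarith
  · have h1 := Nat.le_ceil (1920 * (Real.log k / δ))
    have h2 : 15 * Real.log k ≤ ⌈1920 * (Real.log k / δ)⌉₊ * (δ / 32) / 4 := by
      have := mul_le_mul_of_nonneg_right h1 hδ0.le
      rw [mul_assoc, div_mul_cancel₀ _ hδ0.ne'] at this
      linarith
    have h3 : Real.exp (-(15 * Real.log k)) = ((k : ℝ) ^ 15)⁻¹ := by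
      rw [Real.exp_neg, show (15 : ℝ) * Real.log k = (15 : ℕ) * Real.log k by norm_num,
        Real.exp_nat_mul, Real.exp_log hk0]
    refine (Real.exp_le_exp.2 (neg_le_neg h2)).trans ?_
    rw [h3, inv_le_iff_one_le_mul₀ (by positivity), div_mul_eq_mul_div, le_div_iff₀ (by positivity)]
    have h4 : 1 ≤ 2 * k * δ := by
      rwa [div_le_iff₀ (by positivity), mul_comm] at hδk
    have h5 : 1 ≤ (2 * k * δ) ^ 2 := one_le_pow₀ h4
    have h6 : (2 : ℝ) ^ 12 ≤ k ^ 12 := pow_le_pow_left₀ (by norm_num) hk2 _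
    calc 1 * (12 * (k : ℝ)) ≤ (2 : ℝ) ^ 12 * k * (1 / 256) * 1 := by linarith
      _ ≤ k ^ 12 * k * (1 / 256) * (2 * k * δ) ^ 2 := by gcongr
      _ = (δ / 8) ^ 2 * k ^ 15 := by ring

namespace WeightedGraph

variable {V : Type*} [Fintype V] [DecidableEq V] {G : WeightedGraph V} {k : ℕ} {f : Fin k → V → ℝ}

theorem expansion_nonneg (hw : ∀ v, 0 < G.vertexWeight v) (S : Finset V) : 0 ≤ G.expansion S :=
  div_nonneg (Finset.sum_nonneg fun _ he => (G.weight_pos _ (Finset.mem_filter.1 he).1).le)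
    (Finset.sum_nonneg fun v _ => (hw v).le)

/-- A labelling of the vertices whose classes have small total boundary and concentrated mass. -/
theorem IsOrthonormalSystem.exists_labels (hw : ∀ v, 0 < G.vertexWeight v)
    (hf : G.IsOrthonormalSystem f) (hk : 2 ≤ k) {δ : ℝ} (hδk : 1 / (2 * k) ≤ δ) (hδ1 : δ < 1) :
    ∃ (l : V → ℕ) (P : Finset (Finset ℕ)),
      (∀ T ∈ P, ∀ T' ∈ P, T ≠ T' → Disjoint T T') ∧
      (∀ T ∈ P, 1 / 8 ≤ ∑ v, G.vertexWeight v * (if l v ∈ T then ‖embedding f v‖ ^ 2 else 0)) ∧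
      k * (1 - δ / 8) ≤ (1 + δ / 8) * P.card + 1 / 8 ∧
      ∑ T ∈ P, ∑ u, ∑ v, G.adjacency u v * |(if l u ∈ T then ‖embedding f u‖ ^ 2 else 0) -
        (if l v ∈ T then ‖embedding f v‖ ^ 2 else 0)| ≤
        27 * k * √(45 ^ 2 * (Real.log k / δ)) * √(G.aggregateRayleigh f) := by
  classical
  have hk2 : (2 : ℝ) ≤ k := by exact_mod_cast hk
  have hk0 : (0 : ℝ) < k := by linarith
  have hδ0 : 0 < δ := lt_of_lt_of_le (by positivity) hδk
  obtain ⟨m, hm1, hm2, hm3⟩ := exists_sample_size hk hδk hδ1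
  set F : V → EuclideanSpace ℝ (Fin k) := embedding f with hF
  choose y hy hFy using fun v => exists_unit_direction (by omega : 0 < k) (F v)
  have hV : Nonempty V := by
    by_contra h
    rw [not_nonempty_iff] at h
    have : (0 : ℝ) = k := by simpa using hf.sum_norm_sq
    linarith
  obtain ⟨v₀⟩ := hV
  obtain ⟨Θ, _, q, l, hq, hq1, hsep, hsame⟩ := exists_random_clustering v₀ y hy m
    (ε := (δ / 8) ^ 2 / (12 * k)) (by positivity)
  set μ : V → ℝ := fun v => G.vertexWeight v * ‖F v‖ ^ 2 with hμ
  have hμ0 : ∀ v, 0 ≤ μ v := fun v => mul_nonneg (hw v).le (sq_nonneg _)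
  have hμk : ∑ v, μ v = k := hf.sum_norm_sq
  have hA : ∀ u v, 0 ≤ G.adjacency u v := G.adjacency_nonneg
  have hite : ∀ (p : Prop) [Decidable p], (0 : ℝ) ≤ if p then 0 else 1 := fun p _ => by
    split_ifs <;> norm_num
  have hite' : ∀ (p : Prop) [Decidable p], (0 : ℝ) ≤ if p then 1 else 0 := fun p _ => by
    split_ifs <;> norm_num
  -- X bounds the total ℓ¹ energy of the localized functions whatever the grouping; Y is the mass of
  -- far pairs sharing a label.
  set X : Θ → ℝ := fun θ => ∑ u, ∑ v, G.adjacency u v *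
    (|‖F u‖ ^ 2 - ‖F v‖ ^ 2| + 2 * min (‖F u‖ ^ 2) (‖F v‖ ^ 2) *
      (if l θ u = l θ v then 0 else 1)) with hX
  set Y : Θ → ℝ := fun θ => ∑ v, ∑ u, μ v * μ u * (if δ / 32 ≤ ‖y v - y u‖ ^ 2 then 1 else 0) *
    (if l θ v = l θ u then 1 else 0) with hY
  have hX0 : ∀ θ, 0 ≤ X θ := fun θ => Finset.sum_nonneg fun u _ => Finset.sum_nonneg fun v _ =>
    mul_nonneg (hA u v) (add_nonneg (abs_nonneg _) (mul_nonneg (mul_nonneg zero_le_two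
      (le_min (sq_nonneg _) (sq_nonneg _))) (hite _)))
  have hY0 : ∀ θ, 0 ≤ Y θ := fun θ => Finset.sum_nonneg fun u _ => Finset.sum_nonneg fun v _ =>
    mul_nonneg (mul_nonneg (mul_nonneg (hμ0 _) (hμ0 _)) (hite' _)) (hite' _)
  have hEX : ∑ θ, q θ * X θ ≤ 9 * k * √m * √(G.aggregateRayleigh f) := by
    have e1 : ∑ θ, q θ * X θ = ∑ u, ∑ v, G.adjacency u v * (|‖F u‖ ^ 2 - ‖F v‖ ^ 2| +
        2 * min (‖F u‖ ^ 2) (‖F v‖ ^ 2) *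
          ∑ θ, q θ * (if l θ u = l θ v then 0 else 1)) := by
      simp only [hX, Finset.mul_sum]
      rw [Finset.sum_comm]
      refine Finset.sum_congr rfl fun u _ => ?_
      rw [Finset.sum_comm]
      refine Finset.sum_congr rfl fun v _ => ?_
      have : |‖F u‖ ^ 2 - ‖F v‖ ^ 2| = ∑ θ, q θ * |‖F u‖ ^ 2 - ‖F v‖ ^ 2| := by
        rw [← Finset.sum_mul, hq1, one_mul]
      conv_rhs => rw [this, ← Finset.sum_add_distrib, Finset.mul_sum]
      exact Finset.sum_congr rfl fun θ _ => by ring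
    have hsm : 1 ≤ √m := Real.one_le_sqrt.2 (by exact_mod_cast hm1)
    have e2 : ∀ u v, |‖F u‖ ^ 2 - ‖F v‖ ^ 2| + 2 * min (‖F u‖ ^ 2) (‖F v‖ ^ 2) *
        ∑ θ, q θ * (if l θ u = l θ v then 0 else 1) ≤
        3 * √m * ((‖F u‖ + ‖F v‖) * ‖F u - F v‖) := by
      intro u v
      have h1 : |‖F u‖ ^ 2 - ‖F v‖ ^ 2| ≤ (‖F u‖ + ‖F v‖) * ‖F u - F v‖ := by
        rw [sq_sub_sq, abs_mul, abs_of_nonneg (by positivity)]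
        exact mul_le_mul_of_nonneg_left (abs_norm_sub_norm_le _ _) (by positivity)
      have h2 : min (‖F u‖ ^ 2) (‖F v‖ ^ 2) = min ‖F u‖ ‖F v‖ * min ‖F u‖ ‖F v‖ := by
        rcases le_total ‖F u‖ ‖F v‖ with h | h
        · rw [min_eq_left h, min_eq_left (pow_le_pow_left₀ (norm_nonneg _) h 2), sq]
        · rw [min_eq_right h, min_eq_right (pow_le_pow_left₀ (norm_nonneg _) h 2), sq]
      have h3 := min_norm_mul_norm_sub_le (F u) (F v) (y u) (y v) (hy u) (hy v) (hFy u) (hFy v)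
      have h4 : 2 * min ‖F u‖ ‖F v‖ ≤ ‖F u‖ + ‖F v‖ := by
        linarith [min_le_left ‖F u‖ ‖F v‖, min_le_right ‖F u‖ ‖F v‖]
      have h5 : 0 ≤ min ‖F u‖ ‖F v‖ := le_min (norm_nonneg _) (norm_nonneg _)
      have h6 : 2 * min (‖F u‖ ^ 2) (‖F v‖ ^ 2) *
          ∑ θ, q θ * (if l θ u = l θ v then 0 else 1) ≤
          2 * √m * ((‖F u‖ + ‖F v‖) * ‖F u - F v‖) := by
        rw [h2]
        calc _ ≤ 2 * (min ‖F u‖ ‖F v‖ * min ‖F u‖ ‖F v‖) * (2 * √m * ‖y u - y v‖) := by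
              gcongr
              exact hsep u v
          _ = 2 * √m * ((2 * min ‖F u‖ ‖F v‖) * (min ‖F u‖ ‖F v‖ * ‖y u - y v‖)) := by ring
          _ ≤ _ := by gcongr
      have h7 : 0 ≤ (‖F u‖ + ‖F v‖) * ‖F u - F v‖ := by positivity
      nlinarith
    rw [e1]
    calc _ ≤ ∑ u, ∑ v, G.adjacency u v * (3 * √m * ((‖F u‖ + ‖F v‖) * ‖F u - F v‖)) :=
          Finset.sum_le_sum fun u _ => Finset.sum_le_sum fun v _ =>
            mul_le_mul_of_nonneg_left (e2 u v) (hA u v)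
      _ = 3 * √m * ∑ u, ∑ v, G.adjacency u v * ((‖F u‖ + ‖F v‖) * ‖F u - F v‖) := by
          simp only [Finset.mul_sum]
          exact Finset.sum_congr rfl fun u _ => Finset.sum_congr rfl fun v _ => by ring
      _ ≤ 3 * √m * (3 * k * √(G.aggregateRayleigh f)) := by
          gcongr
          exact hf.sum_adjacency_mul_norm_add_mul_norm_sub_le (by omega)
      _ = _ := by ring
  have hEY : ∑ θ, q θ * Y θ ≤ (δ / 8) ^ 2 * k / 6 := by
    have e1 : ∑ θ, q θ * Y θ = ∑ v, ∑ u, μ v * μ u *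
        (if δ / 32 ≤ ‖y v - y u‖ ^ 2 then 1 else 0) *
          ∑ θ, q θ * (if l θ v = l θ u then 1 else 0) := by
      simp only [hY, Finset.mul_sum]
      rw [Finset.sum_comm]
      refine Finset.sum_congr rfl fun u _ => ?_
      rw [Finset.sum_comm]
      exact Finset.sum_congr rfl fun v _ => Finset.sum_congr rfl fun θ _ => by ring
    have e2 : ∀ v u, (if δ / 32 ≤ ‖y v - y u‖ ^ 2 then (1 : ℝ) else 0) *
          ∑ θ, q θ * (if l θ v = l θ u then 1 else 0) ≤ (δ / 8) ^ 2 / (6 * k) := by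
      intro v u
      split_ifs with h
      · rw [one_mul]
        refine (hsame v u).trans ?_
        have h1 : Real.exp (-(m * ‖y v - y u‖ ^ 2 / 4)) ≤ Real.exp (-(m * (δ / 32) / 4)) := by
          gcongr
        have h2 : (δ / 8) ^ 2 / (6 * k) = (δ / 8) ^ 2 / (12 * k) + (δ / 8) ^ 2 / (12 * k) := by
          field_simp
          norm_num
        linarith
      · rw [zero_mul]
        positivity
    rw [e1]
    calc _ ≤ ∑ v, ∑ u, μ v * μ u * ((δ / 8) ^ 2 / (6 * k)) := by
          refine Finset.sum_le_sum fun v _ => Finset.sum_le_sum fun u _ => ?_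
          rw [mul_assoc]
          exact mul_le_mul_of_nonneg_left (e2 v u) (mul_nonneg (hμ0 v) (hμ0 u))
      _ = _ := by
          simp only [← Finset.sum_mul, ← Finset.mul_sum, hμk]
          field_simp
  -- With η = δ/8, three times the bound on the mean of Y is exactly (η/2)(ηk). The radius δ/32 is
  -- chosen so that 1/(1 - δ/32) ≤ 1 + η/2.
  obtain ⟨θ, hXθ, hYθ⟩ := exists_le_three_mul_expectation q X Y hq hq1 hX0 hY0 hEX hEY
  obtain ⟨P, hP1, hP2, hP3⟩ := exists_label_groups μ hμ0 (fun v u => δ / 32 ≤ ‖y v - y u‖ ^ 2)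
    (η := δ / 8) (by linarith) hμk (fun v _ => by
      have h := sum_near_le_of_isotropic (fun v => G.vertexWeight v) (fun v => (hw v).le) F y hy
        hFy hf.isotropic (Δ := δ / 32) v
      have h1 : (1 - δ / 32) * ∑ u, μ u * (if δ / 32 ≤ ‖y v - y u‖ ^ 2 then 0 else 1) ≤
          (1 - δ / 32) * (1 + δ / 8 / 2) := h.trans (by nlinarith)
      exact le_of_mul_le_mul_left h1 (by linarith)) (l θ) (hYθ.trans (by linarith))
  refine ⟨l θ, P, hP2, fun T hT => (hP1 T hT).trans_eq ?_, hP3, ?_⟩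
  · exact Finset.sum_congr rfl fun v _ => by simp only [hμ]; split_ifs <;> simp
  · have h1 : ∑ T ∈ P, ∑ u, ∑ v, G.adjacency u v * |(if l θ u ∈ T then ‖F u‖ ^ 2 else 0) -
        (if l θ v ∈ T then ‖F v‖ ^ 2 else 0)| ≤ X θ := by
      rw [Finset.sum_comm]
      refine Finset.sum_le_sum fun u _ => ?_
      rw [Finset.sum_comm]
      refine Finset.sum_le_sum fun v _ => ?_
      rw [← Finset.mul_sum]
      exact mul_le_mul_of_nonneg_left
        (sum_abs_localized_sub_le hP2 _ _ (sq_nonneg _) (sq_nonneg _)) (hA u v)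
    refine h1.trans (hXθ.trans ?_)
    have h2 : √(m : ℝ) ≤ √(45 ^ 2 * (Real.log k / δ)) := Real.sqrt_le_sqrt hm2
    calc 3 * (9 * k * √m * √(G.aggregateRayleigh f)) = 27 * k * √m * √(G.aggregateRayleigh f) := by
          ring
      _ ≤ _ := by gcongr

/-- The higher-order Cheeger inequality for an orthonormal system, for `k ≥ 2` and `δ` not much
smaller than `1 / k`. -/
theorem IsOrthonormalSystem.exists_disjoint_sets_of_le (hw : ∀ v, 0 < G.vertexWeight v)
    (hf : G.IsOrthonormalSystem f) (hk : 2 ≤ k) {δ : ℝ} (hδk : 1 / (2 * k) ≤ δ) (hδ1 : δ < 1) :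
    ∃ (r : ℕ) (S : Fin r → Finset V), (1 - δ) * k ≤ r ∧ (∀ i, (S i).Nonempty) ∧
      (∀ i j, i ≠ j → Disjoint (S i) (S j)) ∧
      ∀ i, G.expansion (S i) ≤ 20000 * (1 / δ ^ 3) * √(G.aggregateRayleigh f * Real.log k) := by
  classical
  have hk2 : (2 : ℝ) ≤ k := by exact_mod_cast hk
  have hk0 : (0 : ℝ) < k := by linarith
  have hδ0 : 0 < δ := lt_of_lt_of_le (by positivity) hδk
  have hδk' : 1 ≤ 2 * k * δ := by rwa [div_le_iff₀ (by positivity), mul_comm] at hδk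
  have hL : 0 ≤ Real.log k := Real.log_nonneg (by linarith)
  obtain ⟨l, P, hP, hmass, hcard, hcost⟩ := hf.exists_labels hw hk hδk hδ1
  set F : V → EuclideanSpace ℝ (Fin k) := embedding f with hF
  set g : Finset ℕ → V → ℝ := fun T v => if l v ∈ T then ‖F v‖ ^ 2 else 0 with hg
  have hg0 : ∀ T v, 0 ≤ g T v := fun T v => by
    simp only [hg]
    split_ifs
    exacts [sq_nonneg _, le_rfl]
  set cost : Finset ℕ → ℝ := fun T => ∑ u, ∑ v, G.adjacency u v * |g T u - g T v| with hcostdef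
  have hcost0 : ∀ T, 0 ≤ cost T := fun T => Finset.sum_nonneg fun u _ =>
    Finset.sum_nonneg fun v _ => mul_nonneg (G.adjacency_nonneg u v) (abs_nonneg _)
  set b : ℝ := √(45 ^ 2 * (Real.log k / δ)) * √(G.aggregateRayleigh f) with hb
  have hb0 : 0 ≤ b := by positivity
  have hcost' : ∑ T ∈ P, cost T ≤ 27 * k * b := by
    rw [hb, ← mul_assoc]
    exact hcost
  -- The threshold is 4/δ times the cost 27b per unit of k, so at most δk/4 groups exceed it.
  set Q := P.filter fun T => cost T ≤ 108 * b / δ with hQ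
  have hdrop : ((P.filter fun T => ¬ cost T ≤ 108 * b / δ).card : ℝ) ≤ δ * k / 4 := by
    rcases hb0.eq_or_lt with h0 | h0
    · have : (P.filter fun T => ¬ cost T ≤ 108 * b / δ) = ∅ := by
        refine Finset.filter_eq_empty_iff.2 fun T hT => not_not.2 ?_
        have := Finset.single_le_sum (fun T _ => hcost0 T) hT
        rw [← h0] at hcost' ⊢
        simp only [mul_zero, zero_div] at hcost' ⊢
        exact this.trans hcost'
      rw [this]
      simp only [Finset.card_empty, Nat.cast_zero]
      positivity
    · have h1 : ((P.filter fun T => ¬ cost T ≤ 108 * b / δ).card : ℝ) * (108 * b / δ) ≤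
          27 * k * b := by
        refine le_trans ?_ hcost'
        rw [← nsmul_eq_mul, ← Finset.sum_const]
        exact (Finset.sum_le_sum fun T hT => (not_le.1 (Finset.mem_filter.1 hT).2).le).trans
          (Finset.sum_le_sum_of_subset_of_nonneg (Finset.filter_subset _ _) fun T _ _ => hcost0 T)
      rw [mul_div_assoc', div_le_iff₀ hδ0] at h1
      have h2 : b * (((P.filter fun T => ¬ cost T ≤ 108 * b / δ).card : ℝ) * 108) ≤
          b * (27 * k * δ) := by linarith
      have := le_of_mul_le_mul_left h2 h0
      linarith
  have hQcard : (1 - δ) * k ≤ Q.card := by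
    have h1 : (Q.card : ℝ) + (P.filter fun T => ¬ cost T ≤ 108 * b / δ).card = P.card := by
      exact_mod_cast Finset.card_filter_add_card_filter_not (s := P) fun T => cost T ≤ 108 * b / δ
    -- If |P| ≤ k, then |P| ≥ k - δk/4 - 1/8, and 1/8 ≤ δk/4 because δ ≥ 1/(2k); otherwise |P| > k.
    -- Either way δk/4 more can be lost.
    by_cases h : (P.card : ℝ) ≤ k
    · nlinarith
    · nlinarith
  have hset : ∀ T : Q, ∃ S : Finset V, S.Nonempty ∧ (∀ v ∈ S, l v ∈ T.1) ∧
      G.expansion S ≤ 432 * b / δ := by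
    rintro ⟨T, hT⟩
    obtain ⟨hTP, hTc⟩ := Finset.mem_filter.1 hT
    have hM := hmass T hTP
    change 1 / 8 ≤ ∑ v, G.vertexWeight v * g T v at hM
    obtain ⟨S, hS1, hS2, hS3⟩ := G.exists_expansion_le hw (g T) (hg0 T) (by linarith)
    refine ⟨S, hS1, fun v hv => ?_, ?_⟩
    · by_contra h
      have := hS2 v hv
      simp [hg, h] at this
    · have h1 : G.expansion S * (2 * (1 / 8)) ≤ 108 * b / δ :=
        (mul_le_mul_of_nonneg_left (by linarith) (expansion_nonneg hw S)).trans (hS3.trans hTc)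
      have h2 : 432 * b / δ = 4 * (108 * b / δ) := by ring
      linarith
  choose S hS1 hS2 hS3 using hset
  let e := Q.equivFin
  refine ⟨Q.card, fun i => S (e.symm i), hQcard, fun i => hS1 _, fun i j hij => ?_, fun i => ?_⟩
  · have hne : (e.symm i).1 ≠ (e.symm j).1 := fun h => hij (e.symm.injective (Subtype.ext h))
    have hd := hP _ (Finset.mem_filter.1 (e.symm i).2).1 _ (Finset.mem_filter.1 (e.symm j).2).1 hne
    exact Finset.disjoint_left.2 fun v hi hj =>
      Finset.disjoint_left.1 hd (hS2 _ v hi) (hS2 _ v hj)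
  · refine (hS3 _).trans ?_
    have h1 : b ≤ 45 * (1 / δ) * √(G.aggregateRayleigh f * Real.log k) := by
      have h2 : √(Real.log k / δ) ≤ √(Real.log k) * (1 / δ) := by
        rw [Real.sqrt_div hL, div_eq_mul_one_div]
        gcongr
        exact Real.le_sqrt_of_sq_le (by nlinarith)
      rw [hb, Real.sqrt_mul (by norm_num), Real.sqrt_sq (by norm_num),
        Real.sqrt_mul hf.aggregateRayleigh_nonneg]
      calc _ ≤ 45 * (√(Real.log k) * (1 / δ)) * √(G.aggregateRayleigh f) := by gcongr
        _ = _ := by ring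
    have h3 : 1 / δ ^ 2 ≤ 1 / δ ^ 3 :=
      one_div_le_one_div_of_le (by positivity) (pow_le_pow_of_le_one hδ0.le hδ1.le (by norm_num))
    calc 432 * b / δ ≤ 432 * (45 * (1 / δ) * √(G.aggregateRayleigh f * Real.log k)) / δ := by
          gcongr
      _ = 19440 * (1 / δ ^ 2) * √(G.aggregateRayleigh f * Real.log k) := by
          ring
      _ ≤ _ := by
          gcongr
          norm_num

/-- The higher-order Cheeger inequality for an orthonormal system. -/
theorem IsOrthonormalSystem.exists_disjoint_sets (hw : ∀ v, 0 < G.vertexWeight v)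
    (hf : G.IsOrthonormalSystem f) (h₁ : 1 ≤ k) (h₂ : k ≤ Fintype.card V) {δ : ℝ} (hδ0 : 0 < δ)
    (hδ1 : δ < 1) :
    ∃ (r : ℕ) (S : Fin r → Finset V), ⌈(1 - δ) * (k : ℝ)⌉₊ ≤ r ∧ (∀ i, (S i).Nonempty) ∧
      (∀ i j, i ≠ j → Disjoint (S i) (S j)) ∧
      ∀ i, G.expansion (S i) ≤ 20000 * (1 / δ ^ 3) * √(G.aggregateRayleigh f * Real.log k) := by
  rcases h₁.eq_or_lt with rfl | hk
  · have : Nonempty V := Fintype.card_pos_iff.1 h₂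
    refine ⟨1, fun _ => Finset.univ, Nat.ceil_le.2 (by norm_num; linarith),
      fun _ => Finset.univ_nonempty, fun i j hij => absurd (Subsingleton.elim i j) hij,
      fun i => ?_⟩
    rw [expansion_univ]
    positivity
  have hk0 : (0 : ℝ) < k := by exact_mod_cast h₁
  rcases le_total (1 / (2 * (k : ℝ))) δ with h | h
  · obtain ⟨r, S, hr, hS⟩ := hf.exists_disjoint_sets_of_le hw hk h hδ1
    exact ⟨r, S, Nat.ceil_le.2 hr, hS⟩
  · have hk2 : (2 : ℝ) ≤ k := by exact_mod_cast hk
    -- Below 1/(2k) the value 1/(2k) already suffices: r ≥ k - 1/2 forces r ≥ k, and the bound only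
    -- weakens as δ decreases.
    obtain ⟨r, S, hr, hS1, hS2, hS3⟩ := hf.exists_disjoint_sets_of_le hw hk le_rfl
      (by rw [div_lt_one (by positivity)]; linarith)
    refine ⟨r, S, Nat.ceil_le.2 ?_, hS1, hS2, fun i => (hS3 i).trans ?_⟩
    · have h1 : (k : ℝ) < r + 1 := by
        rw [sub_mul, one_mul, div_mul_eq_mul_div, one_mul, mul_comm 2,
          div_mul_cancel_left₀ hk0.ne'] at hr
        linarith
      have h2 : (k : ℝ) ≤ r := by
        exact_mod_cast Nat.lt_succ_iff.1 (by exact_mod_cast h1)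
      nlinarith
    · gcongr

end WeightedGraph

/-! ### Eigenvectors of the normalized Laplacian -/

namespace WeightedGraph

variable {V : Type*} [Fintype V] [DecidableEq V] (G : WeightedGraph V)

/-- The `j`-th eigenvector of the normalized Laplacian, normalised in `ℓ²(V, w)`. -/
noncomputable def eigenfunction (j v : V) : ℝ :=
  (√(G.vertexWeight v))⁻¹ * G.normalizedLaplacian_isHermitian.eigenvectorBasis j v

variable {G}

theorem innerW_eigenfunction (hw : ∀ v, 0 < G.vertexWeight v) (i j : V) :
    G.innerW (G.eigenfunction i) (G.eigenfunction j) = if i = j then 1 else 0 := by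
  have h := orthonormal_iff_ite.1 G.normalizedLaplacian_isHermitian.eigenvectorBasis.orthonormal i j
  rw [← h, PiLp.inner_apply, innerW]
  refine Finset.sum_congr rfl fun v _ => ?_
  have h1 : G.vertexWeight v * ((√(G.vertexWeight v))⁻¹ * (√(G.vertexWeight v))⁻¹) = 1 := by
    rw [← mul_inv, Real.mul_self_sqrt (hw v).le, mul_inv_cancel₀ (hw v).ne']
  simp only [eigenfunction, RCLike.inner_apply, conj_trivial]
  linear_combination (G.normalizedLaplacian_isHermitian.eigenvectorBasis i v *
    G.normalizedLaplacian_isHermitian.eigenvectorBasis j v) * h1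

/-- Expand the square: the row sums of the adjacency matrix are the vertex weights, so each square
term sums to ⟨f, f⟩. -/
theorem energy_eq_sub (f : V → ℝ) :
    G.energy f = G.innerW f f - ∑ u, ∑ v, G.adjacency u v * f u * f v := by
  have h0 := G.two_mul_energy f
  have h2 : ∑ u, ∑ v, G.adjacency u v * f u ^ 2 = G.innerW f f := by
    simp only [← Finset.sum_mul, ← vertexWeight_eq, innerW]
    exact Finset.sum_congr rfl fun v _ => by ring
  have h3 : ∑ u, ∑ v, G.adjacency u v * f v ^ 2 = G.innerW f f := by
    rw [Finset.sum_comm, ← h2]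
    simp only [G.adjacency_comm]
  have h4 : ∑ u, ∑ v, G.adjacency u v * (f u - f v) ^ 2 =
      ∑ u, ∑ v, G.adjacency u v * f u ^ 2 + ∑ u, ∑ v, G.adjacency u v * f v ^ 2 -
        2 * ∑ u, ∑ v, G.adjacency u v * f u * f v := by
    simp only [Finset.mul_sum, ← Finset.sum_add_distrib, ← Finset.sum_sub_distrib]
    exact Finset.sum_congr rfl fun u _ => Finset.sum_congr rfl fun v _ => by ring
  rw [h4, h2, h3] at h0
  linarith

theorem energy_eigenfunction (hw : ∀ v, 0 < G.vertexWeight v) (j : V) :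
    G.energy (G.eigenfunction j) = G.normalizedLaplacian_isHermitian.eigenvalues j := by
  set b := G.normalizedLaplacian_isHermitian.eigenvectorBasis j with hb
  have hsq : ∑ v, b v * b v = 1 := by
    have h := orthonormal_iff_ite.1
      G.normalizedLaplacian_isHermitian.eigenvectorBasis.orthonormal j j
    rw [if_pos rfl, PiLp.inner_apply] at h
    simpa [sq] using h
  have hL : ∀ v, b v - ∑ u, (√(G.vertexWeight v))⁻¹ * G.adjacency v u *
      (√(G.vertexWeight u))⁻¹ * b u = G.normalizedLaplacian_isHermitian.eigenvalues j * b v := by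
    intro v
    have h := congrFun (G.normalizedLaplacian_isHermitian.mulVec_eigenvectorBasis j) v
    rw [← hb] at h
    rw [Pi.smul_apply, smul_eq_mul] at h
    rw [← h, normalizedLaplacian, Matrix.sub_mulVec, Matrix.one_mulVec, Pi.sub_apply, invSqrtDegree,
      Matrix.mulVec, dotProduct]
    simp only [Matrix.mul_diagonal, Matrix.diagonal_mul]
  rw [energy_eq_sub, innerW_eigenfunction hw, if_pos rfl, ← hsq, ← Finset.sum_sub_distrib]
  calc _ = ∑ v, b v * (G.normalizedLaplacian_isHermitian.eigenvalues j * b v) := by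
        refine Finset.sum_congr rfl fun v _ => ?_
        rw [← hL v, mul_sub, Finset.mul_sum]
        congr 1
        refine Finset.sum_congr rfl fun u _ => ?_
        simp only [eigenfunction, ← hb]
        ring
    _ = G.normalizedLaplacian_isHermitian.eigenvalues j * ∑ v, b v * b v := by
        rw [Finset.mul_sum]
        exact Finset.sum_congr rfl fun v _ => by ring
    _ = _ := by rw [hsq, mul_one]

/-- There is an orthonormal system of `k` functions with Rayleigh quotient at most `λ_k`. -/
theorem exists_orthonormal_aggregateRayleigh_le (hw : ∀ v, 0 < G.vertexWeight v) {k : ℕ}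
    (h₁ : 1 ≤ k) (h₂ : k ≤ Fintype.card V) :
    ∃ f : Fin k → V → ℝ, G.IsOrthonormalSystem f ∧
      G.aggregateRayleigh f ≤ G.eigenvalue k h₁ h₂ := by
  let e : Fin (Fintype.card V) ≃ V := Fintype.equivOfCardEq (Fintype.card_fin _)
  -- Eigenvalues are listed in decreasing order, so the last k indices hold the k smallest ones, and
  -- the first of these indices, n - k, holds λ_k.
  let ι : Fin k → Fin (Fintype.card V) := fun i => ⟨Fintype.card V - k + i, by omega⟩
  have hι : Function.Injective ι := fun i j h => by
    have := congrArg Fin.val h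
    simp only [ι] at this
    exact Fin.ext (by omega)
  have hf : G.IsOrthonormalSystem fun i => G.eigenfunction (e (ι i)) := fun i j => by
    rw [innerW_eigenfunction hw]
    simp only [(e.injective.comp hι).eq_iff (a := i) (b := j), ← Function.comp_apply (f := e)]
  refine ⟨_, hf, ?_⟩
  have hk0 : (0 : ℝ) < k := by exact_mod_cast h₁
  have hsum : ∑ i, G.energy (G.eigenfunction (e (ι i))) ≤ k * G.eigenvalue k h₁ h₂ := by
    have : ∀ i : Fin k, G.energy (G.eigenfunction (e (ι i))) ≤ G.eigenvalue k h₁ h₂ := fun i => by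
      rw [energy_eigenfunction hw, eigenvalue, Matrix.IsHermitian.eigenvalues]
      refine G.normalizedLaplacian_isHermitian.eigenvalues₀_antitone ?_
      rw [show (Fintype.equivOfCardEq (Fintype.card_fin _)).symm (e (ι i)) = ι i from
        e.symm_apply_apply _]
      exact Fin.mk_le_mk.2 (Nat.le_add_right _ _)
    simpa using Finset.sum_le_sum fun i (_ : i ∈ Finset.univ) => this i
  rw [hf.sum_energy h₁] at hsum
  rw [mul_comm] at hsum
  exact le_of_mul_le_mul_left hsum hk0

end WeightedGraph

theorem theorem4p1 :
    ∃ C : ℝ, 0 < C ∧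
      ∀ (V : Type*) [Fintype V] [DecidableEq V] (G : WeightedGraph V),
        (∀ v, 0 < G.vertexWeight v) →
        ∀ (k : ℕ) (h₁ : 1 ≤ k) (h₂ : k ≤ Fintype.card V) (δ : ℝ), 0 < δ → δ < 1 →
          (∀ f : Fin k → V → ℝ, G.IsOrthonormalSystem f →
            ∃ (r : ℕ) (S : Fin r → Finset V),
              ⌈(1 - δ) * (k : ℝ)⌉₊ ≤ r ∧
              (∀ i, (S i).Nonempty) ∧
              (∀ i j, i ≠ j → Disjoint (S i) (S j)) ∧
              ∀ i, G.expansion (S i) ≤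
                C * (1 / δ ^ 3) * Real.sqrt (G.aggregateRayleigh f * Real.log k)) ∧
          (∃ (r : ℕ) (S : Fin r → Finset V),
              ⌈(1 - δ) * (k : ℝ)⌉₊ ≤ r ∧
              (∀ i, (S i).Nonempty) ∧
              (∀ i j, i ≠ j → Disjoint (S i) (S j)) ∧
              ∀ i, G.expansion (S i) ≤
                C * (1 / δ ^ 3) * Real.sqrt (G.eigenvalue k h₁ h₂ * Real.log k)) := by
  refine ⟨20000, by norm_num, fun V _ _ G hw k h₁ h₂ δ hδ0 hδ1 =>
    ⟨fun f hf => hf.exists_disjoint_sets hw h₁ h₂ hδ0 hδ1, ?_⟩⟩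
  obtain ⟨f, hf, hle⟩ := WeightedGraph.exists_orthonormal_aggregateRayleigh_le hw h₁ h₂
  obtain ⟨r, S, hr, hne, hdisj, hS⟩ := hf.exists_disjoint_sets hw h₁ h₂ hδ0 hδ1
  refine ⟨r, S, hr, hne, hdisj, fun i => (hS i).trans ?_⟩
  have hlog : 0 ≤ Real.log k := Real.log_natCast_nonneg k
  gcongr
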